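/- **Setting.** Let $V$ be a countable set and $p:V\times V\to[0,1]$ a transition kernel, i.e. $\sum_y p(x,y)=1$ for all $x$. Let $\alpha:V\to(0,\infty)$ be a localization function for $p$, i.e. $\sum_x\alpha(x)<\infty$ and $\sup_x\sum_y p(x,y)\alpha(y)/\alpha(x)<\infty$, and let $C>0$ be such that $\sum_y p(x,y)\alpha(y)\le C\,\alpha(x)$ for all $x\in V$. For $\zeta\in\mathbb R^V$ put $\|\zeta\|=\sum_x\alpha(x)|\zeta(x)|$, and let $$E_0=\Big\{\eta\in\mathbb N_0^V:\sum_x\eta(x)<\infty\Big\},\qquad E_\alpha=\{\eta\in\mathbb N_0^V:\|\eta\|<\infty\}.$$ Let $F^+,F^-:\mathbb N_0\to\mathbb R$ satisfy $F^+(0)=F^-(0)=0$, $0\le F^+\le F^-$, and $F^+-F^-$ is decreasing (in the weak sense). The marks are $(x,+)$, $(x,-)$ and $(x,y)$ for $x,y\in V$. Their transitions are $\Gamma^{(x,+)}\eta=\eta+\delta_x$, $\Gamma^{(x,-)}\eta=\eta-\delta_x$, $\Gamma^{(x,y)}\eta=\eta-\delta_x+\delta_y$, with rates $R^{(x,+)}(\eta)=F^+(\eta(x))$,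 $R^{(x,-)}(\eta)=F^-(\eta(x))$, $R^{(x,y)}(\eta)=p(x,y)\eta(x)$. On a probability space $(\Omega,\mathcal F,\mathbb P)$ let $(\mathcal X^{\mathfrak m})$, indexed by the marks $\mathfrak m$, be independent Poisson point processes on $(0,\infty)^2$ with Lebesgue intensity. For $\eta\in E_0$ and $t\ge0$ let $\Phi_t(\eta)$ be the following random configuration. Start from $s^0=0$, $\eta^0=\eta$. For $k\ge1$ let $s^k$ be the infimum of the times $r\in(s^{k-1},t]$ for which there are a mark $\mathfrak m$ and $u>0$ with $(r,u)\in\mathcal X^{\mathfrak m}$ and $u<R^{\mathfrak m}(\eta^{k-1})$ (with $\inf\varnothing=\infty$). If $s^k<\infty$, put $\eta^k=\Gamma^{\mathfrak m^k}(\eta^{k-1})$, where $\mathfrak m^k$ is the (almost surely unique) mark for which this happens at time $s^k$. Almost surely there is a $k_\star$ with $s^{k_\star}<\infty=s^{k_\star+1}$; put $\Phi_t(\eta)=\eta^{k_\star}$. **Lemma (extension to $E_\alpha$).** Let $\eta\in E_\alpha$. There are a set $\Omega_\eta\subset\Omega$ of full measure and random configurations $\Phi_t(\eta)$, $t\ge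 0$, with $\Phi_t(\eta)(\omega)\in E_\alpha$ for all $\omega\in\Omega_\eta$ and all $t\ge0$, such that for every $\omega\in\Omega_\eta$, every (coordinatewise) increasing sequence $(\eta_n)$ in $E_0$ with $\|\eta_n-\eta\|\to0$, and every $t\ge0$, $$\|\Phi_t(\eta_n)(\omega)-\Phi_t(\eta)(\omega)\|\longrightarrow0\quad(n\to\infty).$$ In particular the limit does not depend on the choice of the sequence $(\eta_n)$. Moreover, for all $T\ge0$, $A>0$ and $t\ge0$, $$\mathbb P\Big(\sup_{0\le t\le T}\|\Phi_t(\eta)\|>A\Big)\le\frac{e^{(C+1)T}\,\|\eta\|}{A}\qquad\text{and}\qquad\mathbb E\big[\|\Phi_t(\eta)\|\big]<\infty.$$ -/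

import Mathlib

open MeasureTheory ProbabilityTheory Filter Topology
open scoped ENNReal NNReal

namespace ReactionDiffusion

/-! ### Poisson point processes -/

/-- `X` is a Poisson point process on `E` with (diffuse) intensity `ν`, on the probability space
`(Ω, μ)`: counts of measurable sets are random variables, the count of a set of finite intensity
is Poisson distributed, and counts of pairwise disjoint sets are independent. The realization
`X ω` is a set of points, so that `(X ω ∩ B).encard` is the number of points in `B`. -/
structure IsPoissonPointProcess {Ω E : Type*} [MeasurableSpace Ω] [MeasurableSpace E]
    (X : Ω → Set E) (ν : Measure E) (μ : Measure Ω) : Prop where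
  measurable_count : ∀ B : Set E, MeasurableSet B → Measurable fun ω => (X ω ∩ B).encard
  law_count : ∀ B : Set E, MeasurableSet B → ν B ≠ ∞ →
    μ.map (fun ω => (X ω ∩ B).encard)
      = (poissonMeasure (ν B).toNNReal).map (fun n : ℕ => (n : ℕ∞))
  indep_count : ∀ (n : ℕ) (B : Fin n → Set E), (∀ i, MeasurableSet (B i)) →
    Pairwise (fun i j => Disjoint (B i) (B j)) →
    iIndepFun (fun i ω => (X ω ∩ B i).encard) μ

/-- The σ-algebra on `Ω` generated by all the counts of the point process `X`. -/
@[reducible] noncomputable def countSigma {Ω E : Type*} [MeasurableSpace E] (X : Ω → Set E) : MeasurableSpace Ω :=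
  ⨆ B : {B : Set E // MeasurableSet B},
    MeasurableSpace.comap (fun ω => (X ω ∩ B.1).encard) ⊤

/-! ### Kernels, localization functions, reaction functions -/

/-- `p` is a transition kernel on `V`. -/
structure IsTransitionKernel {V : Type*} (p : V → V → ℝ) : Prop where
  nonneg : ∀ x y, 0 ≤ p x y
  hasSum_one : ∀ x, HasSum (p x) 1

/-- `α` is a localization function for `p`. -/
structure IsLocalization {V : Type*} (p : V → V → ℝ) (α : V → ℝ) : Prop where
  pos : ∀ x, 0 < α x
  summable : Summable α
  bddAbove : BddAbove (Set.range fun x => ∑' y, p x y * (α y / α x))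

/-- The assumptions on the birth and death rates `Fp = F⁺` and `Fm = F⁻`. -/
structure IsReactionPair (Fp Fm : ℕ → ℝ) : Prop where
  birth_zero : Fp 0 = 0
  death_zero : Fm 0 = 0
  birth_nonneg : ∀ n, 0 ≤ Fp n
  birth_le_death : ∀ n, Fp n ≤ Fm n
  antitone_sub : Antitone fun n => Fp n - Fm n

/-! ### Configurations -/

/-- The weighted norm `∑ x, α x * |ζ x|`, as an extended nonnegative real number. -/
noncomputable def alphaNorm {V : Type*} (α : V → ℝ) (ζ : V → ℝ) : ℝ≥0∞ :=
  ∑' x, ENNReal.ofReal (α x * |ζ x|)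

/-- A particle configuration, viewed as a real-valued function. -/
def toRealConf {V : Type*} (η : V → ℕ) : V → ℝ := fun x => (η x : ℝ)

/-- The finite configurations. -/
def finiteConf (V : Type*) : Set (V → ℕ) := {η | Summable (toRealConf η)}

/-- The `α`-summable configurations. -/
def alphaConf {V : Type*} (α : V → ℝ) : Set (V → ℕ) := {η | alphaNorm α (toRealConf η) < ∞}

/-! ### Marks, transitions and rates -/

/-- The birth marks `(x,+)`, the death marks `(x,-)` and the jump marks `(x,y)`. -/
inductive Mark (V : Type*) where
  | birth (x : V) : Mark V
  | death (x : V) : Mark V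
  | jump (x y : V) : Mark V

open Classical in
/-- The configuration with a single particle, at `x`. -/
noncomputable def single {V : Type*} (x : V) : V → ℕ := fun z => if z = x then 1 else 0

/-- The transition operators. The subtractions are only ever used at sites that hold a particle,
because the rates of the marks `(x,-)` and `(x,y)` vanish when `η x = 0`. -/
noncomputable def transition {V : Type*} : Mark V → (V → ℕ) → (V → ℕ)
  | .birth x, η => η + single x
  | .death x, η => η - single x
  | .jump x y, η => η - single x + single y

/-- The transition rates. -/
def rate {V : Type*} (p : V → V → ℝ) (Fp Fm : ℕ → ℝ) : Mark V → (V → ℕ) → ℝ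
  | .birth x, η => Fp (η x)
  | .death x, η => Fm (η x)
  | .jump x y, η => p x y * (η x : ℝ)

/-! ### The flow on finite configurations -/

section Flow

variable {V : Type*} (p : V → V → ℝ) (Fp Fm : ℕ → ℝ) (X : Mark V → Set (ℝ × ℝ))

/-- The marks that are active at time `r` when the configuration is `η`, for the realization `X`
of the point processes. -/
def activeMarks (r : ℝ) (η : V → ℕ) : Set (Mark V) :=
  {m | ∃ u : ℝ, 0 < u ∧ (r, u) ∈ X m ∧ u < rate p Fp Fm m η}

/-- The first time in `(s, t]` at which some mark is active for `η`; it is `⊤` if there is none. -/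
noncomputable def nextTime (t : ℝ) (s : EReal) (η : V → ℕ) : EReal :=
  sInf ((fun r : ℝ => (r : EReal)) ''
    {r : ℝ | s < (r : EReal) ∧ r ≤ t ∧ (activeMarks p Fp Fm X r η).Nonempty})

open Classical in
/-- One step of the recursion: from `(s^{k-1}, η^{k-1})` to `(s^k, η^k)`. The configuration is
left alone if `s^k = ⊤`. The active mark at time `s^k` is almost surely unique. -/
noncomputable def flowStep (t : ℝ) (q : EReal × (V → ℕ)) : EReal × (V → ℕ) :=
  (nextTime p Fp Fm X t q.1 q.2,
    if h : nextTime p Fp Fm X t q.1 q.2 ≠ ⊤ ∧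
        (activeMarks p Fp Fm X (nextTime p Fp Fm X t q.1 q.2).toReal q.2).Nonempty then
      transition h.2.some q.2
    else q.2)

/-- The transition times and configurations `(s^k, η^k)`, with `s^0 = s` and `η^0 = η`. -/
noncomputable def flowSeq (s t : ℝ) (η : V → ℕ) (k : ℕ) : EReal × (V → ℕ) :=
  (flowStep p Fp Fm X t)^[k] ((s : EReal), η)

open Classical in
/-- The flow over `[s, t]` started from `η`: the configuration `η^k` for the `k` such that
`s^k < ⊤` and `s^{k+1} = ⊤`. (For finite `η` such a `k` exists almost surely; the value `η` in the
other case is a convention.) -/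
noncomputable def flow (s t : ℝ) (η : V → ℕ) : V → ℕ :=
  if h : ∃ k, (flowSeq p Fp Fm X s t η k).1 < ⊤ ∧ (flowSeq p Fp Fm X s t η (k + 1)).1 = ⊤ then
    (flowSeq p Fp Fm X s t η (Nat.find h)).2
  else η

end Flow

end ReactionDiffusion

/-!
A configuration with finitely many particles evolves like a pure jump process driven by Poisson
points. Cut `(0, T]` into slices of length `h`, and perform in each slice the transition of its
point if exactly one point lies below the rate of its mark. The slices are independent, so this is
a Markov chain, and a drift bound for a function `f` of the configuration gives
`𝔼 f ≤ (1 + h c) ^ j f(η)` after `j` slices and, on stopping when `f` exceeds a level, a maximal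
inequality. The chain and the flow can only differ if some slice holds two relevant points. As
long as the number of particles stays bounded this has probability `O(h²)` for each slice, hence
`O(h)` altogether, and the maximal inequality for the number of particles excludes that it gets
large. So along a subsequence of meshes the chain is eventually the flow, almost surely, and the
flow inherits the estimates; for the weighted norm, `∑ y, p x y * α y ≤ C * α x` is the drift
bound.

A birth fires for the smaller of two ordered configurations alone only at a site where the larger
one has more particles, and deaths and jumps that fire for the larger one alone happen at such
sites too. Hence the flow is monotone in the initial configuration, the flows started from finite
restrictions of `η` increase, and the maximal inequality keeps their limit in `E_α`. Any other
increasing sequence with limit `η` interlaces with the restrictions, because at each site it is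
eventually equal to `η`, and so it leads to the same limit.
-/

namespace ReactionDiffusion

/-! ### Evolutions and attractiveness -/

section Evolution

variable {M S : Type*} {Γ : M → S → S} {R : M → S → ℝ} {X : M → Set (ℝ × ℝ)}

/-- The marks with rates `R` that have a point of the realization `X` below the graph of their rate,
at time `r` in the state `z`. -/
def active (R : M → S → ℝ) (X : M → Set (ℝ × ℝ)) (r : ℝ) (z : S) : Set M :=
  {m | ∃ u : ℝ, 0 < u ∧ (r, u) ∈ X m ∧ u < R m z}

/-- `Evolves Γ R X s z t w`: the state `z` at time `s` becomes `w` at time `t`, through finitely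
many transitions, each of them at a time with exactly one active mark. -/
inductive Evolves (Γ : M → S → S) (R : M → S → ℝ) (X : M → Set (ℝ × ℝ)) : ℝ → S → ℝ → S → Prop
  | rest {s t : ℝ} {z : S} (hst : s ≤ t) (quiet : ∀ r, s < r → r ≤ t → active R X r z = ∅) :
      Evolves Γ R X s z t z
  | jump {s r t : ℝ} {z w : S} {m : M} (hsr : s < r) (hrt : r ≤ t)
      (quiet : ∀ r', s < r' → r' < r → active R X r' z = ∅) (hm : active R X r z = {m})
      (tail : Evolves Γ R X r (Γ m z) t w) : Evolves Γ R X s z t w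

lemma Evolves.le {s t : ℝ} {z w : S} (h : Evolves Γ R X s z t w) : s ≤ t := by
  cases h with
  | rest hst => exact hst
  | jump hsr hrt => exact hsr.le.trans hrt

lemma Evolves.prepend {s r t : ℝ} {z w : S} (hsr : s ≤ r)
    (quiet : ∀ r', s < r' → r' ≤ r → active R X r' z = ∅) (h : Evolves Γ R X r z t w) :
    Evolves Γ R X s z t w := by
  cases h with
  | rest hrt quiet' =>
    exact .rest (hsr.trans hrt) fun u hsu hut =>
      (le_or_gt u r).elim (quiet u hsu) fun hru => quiet' u hru hut
  | jump hrv hvt quiet' hm tail =>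
    exact .jump (hsr.trans_lt hrv) hvt (fun u hsu huv =>
      (le_or_gt u r).elim (quiet u hsu) fun hru => quiet' u hru huv) hm tail

lemma Evolves.trans {s r t : ℝ} {x y z : S} (h : Evolves Γ R X s x r y)
    (h' : Evolves Γ R X r y t z) : Evolves Γ R X s x t z := by
  induction h with
  | rest hsr quiet => exact h'.prepend hsr quiet
  | jump hsu hur quiet hm _ ih => exact .jump hsu (hur.trans h'.le) quiet hm (ih h')

/-- No two marks have points at the same positive time. -/
def NoSimultaneousPoints (X : M → Set (ℝ × ℝ)) : Prop :=
  ∀ ⦃m m' : M⦄ ⦃r u u' : ℝ⦄, 0 < r → 0 < u → 0 < u' → (r, u) ∈ X m → (r, u') ∈ X m' → m = m'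

lemma NoSimultaneousPoints.eq_of_mem_active (hX : NoSimultaneousPoints X) {r : ℝ} (hr : 0 < r)
    {m m' : M} {z w : S} (hm : m ∈ active R X r z) (hm' : m' ∈ active R X r w) : m = m' := by
  obtain ⟨u, hu, hmem, -⟩ := hm
  obtain ⟨u', hu', hmem', -⟩ := hm'
  exact hX hr hu hu' hmem hmem'

/-- Attractiveness of the dynamics with transitions `Γ` and rates `R`: a transition that occurs for
both of two ordered states, or for only one of them, respects their order. -/
structure IsAttractive [Preorder S] (Γ : M → S → S) (R : M → S → ℝ) : Prop where
  monotone : ∀ m, Monotone (Γ m)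
  transition_le : ∀ ⦃m z w⦄, z ≤ w → R m w < R m z → Γ m z ≤ w
  le_transition : ∀ ⦃m z w⦄, z ≤ w → R m z < R m w → z ≤ Γ m w

section Attractive

variable [Preorder S] {s r t : ℝ} {z w w' : S} {m : M}

lemma IsAttractive.transition_le_of_mem_active (hΓ : IsAttractive Γ R) (hle : z ≤ w)
    (hz : m ∈ active R X r z) (hw : m ∉ active R X r w) : Γ m z ≤ w := by
  obtain ⟨u, hu, hmem, hlt⟩ := hz
  exact hΓ.transition_le hle (lt_of_not_ge fun h => hw ⟨u, hu, hmem, hlt.trans_le h⟩)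

lemma IsAttractive.le_transition_of_mem_active (hΓ : IsAttractive Γ R) (hle : z ≤ w)
    (hz : m ∉ active R X r z) (hw : m ∈ active R X r w) : z ≤ Γ m w := by
  obtain ⟨u, hu, hmem, hlt⟩ := hw
  exact hΓ.le_transition hle (lt_of_not_ge fun h => hz ⟨u, hu, hmem, hlt.trans_le h⟩)

lemma Evolves.le_of_quiet (hΓ : IsAttractive Γ R) (h : Evolves Γ R X s w t w') (hle : z ≤ w)
    (quiet : ∀ r, s < r → r ≤ t → active R X r z = ∅) : z ≤ w' := by
  induction h with
  | rest => exact hle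
  | jump hsr hrt _ hm _ ih =>
    refine ih (hΓ.le_transition_of_mem_active hle ?_ (hm ▸ Set.mem_singleton _))
      fun u hu => quiet u (hsr.trans hu)
    exact quiet _ hsr hrt ▸ Set.notMem_empty _

lemma Evolves.exists_after_jump (hΓ : IsAttractive Γ R) (hX : NoSimultaneousPoints X)
    (h : Evolves Γ R X s w t w') (hle : z ≤ w) (hs : 0 ≤ s) (hsr : s < r) (hrt : r ≤ t)
    (quiet : ∀ r', s < r' → r' < r → active R X r' z = ∅) (hm : active R X r z = {m}) :
    ∃ v, Γ m z ≤ v ∧ Evolves Γ R X r v t w' := by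
  have hmz : m ∈ active R X r z := hm ▸ Set.mem_singleton m
  induction h with
  | @rest s t w _ quiet' =>
    refine ⟨w, hΓ.transition_le_of_mem_active hle hmz ?_,
      .rest hrt fun u hru => quiet' u (hsr.trans hru)⟩
    exact quiet' r hsr hrt ▸ Set.notMem_empty m
  | @jump s r' t w w' m' hsr' hrt' quiet' hm' tail ih =>
    have hmw : m' ∈ active R X r' w := hm' ▸ Set.mem_singleton m'
    rcases lt_trichotomy r r' with hlt | rfl | hlt
    · refine ⟨w, hΓ.transition_le_of_mem_active hle hmz ?_,
        .jump hlt hrt' (fun u hru => quiet' u (hsr.trans hru)) hm' tail⟩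
      exact quiet' r hsr hlt ▸ Set.notMem_empty m
    · obtain rfl := hX.eq_of_mem_active (hs.trans_lt hsr) hmz hmw
      exact ⟨_, hΓ.monotone m hle, tail⟩
    · refine ih (hΓ.le_transition_of_mem_active hle ?_ hmw) (hs.trans hsr'.le) hlt hrt
        fun u hu => quiet u (hsr'.trans hu)
      exact quiet r' hsr' hlt ▸ Set.notMem_empty m'

lemma Evolves.mono (hΓ : IsAttractive Γ R) (hX : NoSimultaneousPoints X) {z' : S} (hs : 0 ≤ s)
    (hz : Evolves Γ R X s z t z') (hw : Evolves Γ R X s w t w') (hle : z ≤ w) : z' ≤ w' := by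
  induction hz generalizing w with
  | rest _ quiet => exact hw.le_of_quiet hΓ hle quiet
  | jump hsr hrt quiet hm _ ih =>
    obtain ⟨v, hv, hev⟩ := hw.exists_after_jump hΓ hX hle hs hsr hrt quiet hm
    exact ih (hs.trans hsr.le) hev hv

end Attractive

end Evolution

section Flow

variable {V : Type*} {p : V → V → ℝ} {Fp Fm : ℕ → ℝ} {X : Mark V → Set (ℝ × ℝ)}
  {s r t : ℝ} {η ζ : V → ℕ} {m : Mark V}

lemma nextTime_eq_top (quiet : ∀ r, s < r → r ≤ t → activeMarks p Fp Fm X r η = ∅) :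
    nextTime p Fp Fm X t s η = ⊤ := by
  rw [nextTime, sInf_eq_top]
  rintro _ ⟨r, ⟨hsr, hrt, hne⟩, rfl⟩
  exact absurd (quiet r (by exact_mod_cast hsr) hrt) hne.ne_empty

lemma nextTime_eq_coe (hsr : s < r) (hrt : r ≤ t)
    (quiet : ∀ r', s < r' → r' < r → activeMarks p Fp Fm X r' η = ∅)
    (hne : (activeMarks p Fp Fm X r η).Nonempty) : nextTime p Fp Fm X t s η = r := by
  refine IsLeast.csInf_eq ⟨⟨r, ⟨by exact_mod_cast hsr, hrt, hne⟩, rfl⟩, ?_⟩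
  rintro _ ⟨r', ⟨hsr', -, hne'⟩, rfl⟩
  refine EReal.coe_le_coe_iff.2 (le_of_not_gt fun hlt => ?_)
  exact hne'.ne_empty (quiet r' (by exact_mod_cast hsr') hlt)

lemma flowSeq_succ_of_active (hsr : s < r) (hrt : r ≤ t)
    (quiet : ∀ r', s < r' → r' < r → activeMarks p Fp Fm X r' η = ∅)
    (hm : activeMarks p Fp Fm X r η = {m}) (k : ℕ) :
    flowSeq p Fp Fm X s t η (k + 1) = flowSeq p Fp Fm X r t (transition m η) k := by
  have hne : (activeMarks p Fp Fm X r η).Nonempty := hm ▸ Set.singleton_nonempty m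
  have hnext := nextTime_eq_coe hsr hrt quiet hne
  have hstep : flowStep p Fp Fm X t ((s : EReal), η) = ((r : EReal), transition m η) := by
    have hsome (h : (activeMarks p Fp Fm X r η).Nonempty) : h.some = m :=
      Set.mem_singleton_iff.1 (hm.subset h.some_mem)
    simp only [flowStep, hnext, EReal.toReal_coe, hne, hsome, ne_eq, EReal.coe_ne_top,
      not_false_eq_true, and_self, dite_true]
  rw [flowSeq, Function.iterate_succ_apply, hstep, flowSeq]

lemma flow_eq_flowSeq_snd {k : ℕ} (hlt : ∀ j ≤ k, (flowSeq p Fp Fm X s t η j).1 < ⊤)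
    (htop : (flowSeq p Fp Fm X s t η (k + 1)).1 = ⊤) :
    flow p Fp Fm X s t η = (flowSeq p Fp Fm X s t η k).2 := by
  have hk := And.intro (hlt k le_rfl) htop
  rw [flow, dif_pos ⟨k, hk⟩, (Nat.find_eq_iff _).2 ⟨hk, fun j hjk h => (hlt (j + 1) hjk).ne h.2⟩]

lemma Evolves.exists_flowSeq_snd_eq (h : Evolves transition (rate p Fp Fm) X s η t ζ) :
    ∃ k, (∀ j ≤ k, (flowSeq p Fp Fm X s t η j).1 < ⊤) ∧
      (flowSeq p Fp Fm X s t η (k + 1)).1 = ⊤ ∧ (flowSeq p Fp Fm X s t η k).2 = ζ := by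
  induction h with
  | @rest s t η _ quiet =>
    refine ⟨0, fun j hj => ?_, nextTime_eq_top quiet, rfl⟩
    exact Nat.le_zero.1 hj ▸ EReal.coe_lt_top s
  | @jump s r t η ζ m hsr hrt quiet hm _ ih =>
    obtain ⟨k, hlt, htop, hsnd⟩ := ih
    have hsucc := flowSeq_succ_of_active (t := t) hsr hrt quiet hm
    refine ⟨k + 1, fun j hj => ?_, by rw [hsucc, htop], by rw [hsucc, hsnd]⟩
    cases j with
    | zero => exact EReal.coe_lt_top s
    | succ j => exact hsucc j ▸ hlt j (Nat.le_of_succ_le_succ hj)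

lemma Evolves.flow_eq (h : Evolves transition (rate p Fp Fm) X s η t ζ) :
    flow p Fp Fm X s t η = ζ := by
  obtain ⟨k, hlt, htop, hsnd⟩ := h.exists_flowSeq_snd_eq
  rw [flow_eq_flowSeq_snd hlt htop, hsnd]

end Flow

/-! ### Poisson counts in time slices -/

section PoissonCounts

lemma poissonMeasure_compl_zero_le (l : ℝ≥0) : poissonMeasure l {0}ᶜ ≤ l := by
  rw [prob_compl_eq_one_sub (measurableSet_singleton 0), poissonMeasure_singleton,
    tsub_le_iff_right, ← ENNReal.ofReal_coe_nnreal,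
    ← ENNReal.ofReal_add l.coe_nonneg (by positivity), ENNReal.one_le_ofReal]
  have := Real.add_one_le_exp (-(l : ℝ))
  simp only [pow_zero, Nat.factorial_zero, Nat.cast_one, mul_one, div_one]
  linarith

lemma poissonMeasure_compl_zero_one_le (l : ℝ≥0) : poissonMeasure l {0, 1}ᶜ ≤ l ^ 2 := by
  have hsplit : poissonMeasure l {0, 1} = poissonMeasure l {0} + poissonMeasure l {1} := by
    rw [Set.insert_eq, measure_union (by simp) (measurableSet_singleton 1)]
  rw [prob_compl_eq_one_sub (MeasurableSet.of_discrete), hsplit, poissonMeasure_singleton,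
    poissonMeasure_singleton, tsub_le_iff_right, ← ENNReal.ofReal_coe_nnreal,
    ← ENNReal.ofReal_pow l.coe_nonneg, ← ENNReal.ofReal_add (by positivity) (by positivity),
    ← ENNReal.ofReal_add (by positivity) (by positivity), ENNReal.one_le_ofReal]
  have hexp := Real.add_one_le_exp (-(l : ℝ))
  simp only [pow_zero, Nat.factorial_zero, Nat.cast_one, mul_one, div_one, pow_one,
    Nat.factorial_one]
  nlinarith [hexp, l.coe_nonneg]

variable {Ω : Type*} [MeasurableSpace Ω] {μ : Measure Ω} {N : Ω → ℕ∞} {l : ℝ≥0}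

lemma measure_count_mem (hN : Measurable N)
    (hl : μ.map N = (poissonMeasure l).map (fun n : ℕ => (n : ℕ∞))) (s : Set ℕ∞) :
    μ {ω | N ω ∈ s} = poissonMeasure l {n | (n : ℕ∞) ∈ s} := by
  have := congrArg (fun ν : Measure ℕ∞ => ν s) hl
  rwa [Measure.map_apply hN .of_discrete, Measure.map_apply .of_discrete .of_discrete] at this

lemma measure_count_eq_one (hN : Measurable N)
    (hl : μ.map N = (poissonMeasure l).map (fun n : ℕ => (n : ℕ∞))) :
    μ {ω | N ω = 1} = l * μ {ω | N ω = 0} := by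
  have hsingle (k : ℕ) : μ {ω | N ω = k} = poissonMeasure l {k} := by
    simpa only [Set.mem_singleton_iff, Nat.cast_inj, Set.ofPred_eq_eq_singleton]
      using measure_count_mem hN hl {(k : ℕ∞)}
  have h0 := hsingle 0
  have h1 := hsingle 1
  rw [Nat.cast_zero] at h0
  rw [Nat.cast_one] at h1
  rw [h1, h0, poissonMeasure_singleton, poissonMeasure_singleton, ← ENNReal.ofReal_coe_nnreal,
    ← ENNReal.ofReal_mul l.coe_nonneg]
  simp [mul_comm]

lemma measure_one_le_count (hN : Measurable N)
    (hl : μ.map N = (poissonMeasure l).map (fun n : ℕ => (n : ℕ∞))) :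
    μ {ω | 1 ≤ N ω} ≤ l := by
  refine ((measure_count_mem hN hl (Set.Ici 1)).trans_le (measure_mono fun n hn => ?_)).trans
    (poissonMeasure_compl_zero_le l)
  rintro rfl
  simp at hn

lemma measure_two_le_count (hN : Measurable N)
    (hl : μ.map N = (poissonMeasure l).map (fun n : ℕ => (n : ℕ∞))) :
    μ {ω | 2 ≤ N ω} ≤ l ^ 2 := by
  refine ((measure_count_mem hN hl (Set.Ici 2)).trans_le (measure_mono fun n hn => ?_)).trans
    (poissonMeasure_compl_zero_one_le l)
  have hn : 2 ≤ n := by exact_mod_cast (show (2 : ℕ∞) ≤ n from hn)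
  rintro (rfl | rfl) <;> omega

end PoissonCounts

section Slices

/-- The points of the `i`-th time slice of length `h` that are below the height `c`. -/
def slice (h : ℝ) (i : ℕ) (c : ℝ) : Set (ℝ × ℝ) :=
  Set.Ioc (i * h) ((i + 1) * h) ×ˢ Set.Ioo 0 c

lemma measurableSet_slice (h : ℝ) (i : ℕ) (c : ℝ) : MeasurableSet (slice h i c) :=
  measurableSet_Ioc.prod measurableSet_Ioo

lemma slice_subset_slice (h : ℝ) (i : ℕ) {c d : ℝ} (hcd : c ≤ d) : slice h i c ⊆ slice h i d :=
  Set.prod_mono le_rfl (Set.Ioo_subset_Ioo_right hcd)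

lemma disjoint_slice {h : ℝ} (hh : 0 ≤ h) {i j : ℕ} (hij : i ≠ j) (c d : ℝ) :
    Disjoint (slice h i c) (slice h j d) := by
  refine Set.Disjoint.set_prod_left ?_ _ _
  have hmono : Monotone fun k : ℕ => (k : ℝ) * h := fun k k' hk =>
    mul_le_mul_of_nonneg_right (Nat.cast_le.2 hk) hh
  simpa [Function.onFun] using hmono.pairwise_disjoint_on_Ioc_succ hij

lemma exists_mem_Ioc_slice {h r : ℝ} (hr : 0 < r) {n : ℕ} (hrn : r ≤ n * h) :
    ∃ i < n, r ∈ Set.Ioc (i * h) ((i + 1) * h) := by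
  induction n with
  | zero => exact absurd hr (by simpa using hrn)
  | succ n ih =>
    rcases le_or_gt r (n * h) with hle | hlt
    · exact (ih hle).imp fun i hi => ⟨hi.1.trans n.lt_succ_self, hi.2⟩
    · exact ⟨n, n.lt_succ_self, hlt, by exact_mod_cast hrn⟩

lemma volume_restrict_slice {h : ℝ} (hh : 0 ≤ h) (i : ℕ) (c : ℝ) :
    ((volume : Measure (ℝ × ℝ)).restrict (Set.Ioi 0 ×ˢ Set.Ioi 0)) (slice h i c)
      = ENNReal.ofReal h * ENNReal.ofReal c := by
  have hpos : slice h i c ⊆ Set.Ioi 0 ×ˢ Set.Ioi 0 :=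
    Set.prod_mono (fun r hr => (by positivity : 0 ≤ i * h).trans_lt hr.1) fun u hu => hu.1
  rw [Measure.restrict_apply (measurableSet_slice h i c), Set.inter_eq_left.2 hpos, slice,
    Measure.volume_eq_prod, Measure.prod_prod, Real.volume_Ioc, Real.volume_Ioo]
  congr 2 <;> ring

/-- The length of the slices when `[0, T]` is cut into `n + 1` slices. -/
noncomputable def mesh (T : ℝ) (n : ℕ) : ℝ := T / (n + 1 : ℕ)

lemma mesh_nonneg {T : ℝ} (hT : 0 ≤ T) (n : ℕ) : 0 ≤ mesh T n :=
  div_nonneg hT (Nat.cast_nonneg _)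

lemma succ_mul_mesh (T : ℝ) (n : ℕ) : ((n + 1 : ℕ) : ℝ) * mesh T n = T :=
  mul_div_cancel₀ T (Nat.cast_ne_zero.2 n.succ_ne_zero)

lemma tendsto_succ_mul_mesh_sq {T : ℝ} (hT : 0 ≤ T) {D : ℝ≥0∞} (hD : D ≠ ∞) :
    Tendsto (fun n : ℕ => ((n + 1 : ℕ) : ℝ≥0∞) * (ENNReal.ofReal (mesh T n) ^ 2 * D))
      atTop (𝓝 0) := by
  have hlim : Tendsto (fun n => T * mesh T n) atTop (𝓝 (T * 0)) :=
    ((tendsto_const_div_atTop_nhds_zero_nat T).comp (tendsto_add_atTop_nat 1)).const_mul T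
  have hlimD := ENNReal.Tendsto.mul_const (ENNReal.tendsto_ofReal hlim) (.inr hD)
  rw [mul_zero, ENNReal.ofReal_zero, zero_mul] at hlimD
  refine hlimD.congr fun n => ?_
  rw [← mul_assoc, ← ENNReal.ofReal_pow (mesh_nonneg hT n), ← ENNReal.ofReal_natCast,
    ← ENNReal.ofReal_mul (Nat.cast_nonneg _), sq, ← mul_assoc, succ_mul_mesh]

end Slices

section Noise

variable {M Ω : Type*}

/-- The number of points with mark `m` in the `i`-th time slice of length `h`, below the height
`c`. -/
noncomputable def sliceCount (X : M → Ω → Set (ℝ × ℝ)) (h : ℝ) (i : ℕ) (m : M) (c : ℝ) (ω : Ω) :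
    ℕ∞ :=
  (X m ω ∩ slice h i c).encard

/-- The driving noise of the dynamics: independent Poisson point processes on `(0, ∞)²` with
Lebesgue intensity, one for each mark. -/
structure IsPoissonNoise [MeasurableSpace Ω] (X : M → Ω → Set (ℝ × ℝ)) (μ : Measure Ω) : Prop where
  poisson : ∀ m, IsPoissonPointProcess (X m)
    ((volume : Measure (ℝ × ℝ)).restrict (Set.Ioi 0 ×ˢ Set.Ioi 0)) μ
  iIndep_countSigma : iIndep (fun m => countSigma (X m)) μ

variable {X : M → Ω → Set (ℝ × ℝ)} {h : ℝ} {i : ℕ}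

lemma one_le_sliceCount {m : M} {c : ℝ} {ω : Ω} {q : ℝ × ℝ} (hq : q ∈ X m ω ∩ slice h i c) :
    1 ≤ sliceCount X h i m c ω :=
  Set.one_le_encard_iff_nonempty.2 ⟨q, hq⟩

lemma two_le_sliceCount {m : M} {c : ℝ} {ω : Ω} {q q' : ℝ × ℝ} (hne : q ≠ q')
    (hq : q ∈ X m ω ∩ slice h i c) (hq' : q' ∈ X m ω ∩ slice h i c) :
    2 ≤ sliceCount X h i m c ω := by
  rw [← Set.encard_pair hne]
  exact Set.encard_le_encard (Set.insert_subset hq (Set.singleton_subset_iff.2 hq'))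

lemma comap_sliceCount_le_countSigma (m : M) (c : ℝ) :
    MeasurableSpace.comap (sliceCount X h i m c) ⊤ ≤ countSigma (X m) :=
  le_iSup (fun B : {B : Set (ℝ × ℝ) // MeasurableSet B} =>
    MeasurableSpace.comap (fun ω => (X m ω ∩ B.1).encard) ⊤) ⟨_, measurableSet_slice h i c⟩

lemma measurableSet_countSigma_sliceCount (m : M) (c : ℝ) (s : Set ℕ∞) :
    MeasurableSet[countSigma (X m)] {ω | sliceCount X h i m c ω ∈ s} :=
  comap_sliceCount_le_countSigma m c _ ⟨s, trivial, rfl⟩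

/-- The events that depend only on the slices in `I`, through the counts of the points with mark
`m` below the height `c m i` in the `i`-th slice. There is a single height for each mark and slice
because the definition of a Poisson point process only gives independence of the counts of disjoint
sets. -/
@[reducible] noncomputable def slicesSigma (X : M → Ω → Set (ℝ × ℝ)) (h : ℝ) (c : M → ℕ → ℝ)
    (I : Set ℕ) : MeasurableSpace Ω :=
  ⨆ q ∈ (Prod.snd ⁻¹' I : Set (M × ℕ)),
    MeasurableSpace.comap (sliceCount X h q.2 q.1 (c q.1 q.2)) ⊤

variable {c c' : M → ℕ → ℝ} {I J : Set ℕ}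

lemma slicesSigma_mono (hIJ : I ⊆ J) : slicesSigma X h c I ≤ slicesSigma X h c J :=
  biSup_mono fun _ hq => hIJ hq

lemma slicesSigma_congr (hc : ∀ m, ∀ i ∈ I, c m i = c' m i) :
    slicesSigma X h c I = slicesSigma X h c' I :=
  biSup_congr fun q hq => by rw [hc q.1 q.2 hq]

lemma measurableSet_slicesSigma_sliceCount (c : M → ℕ → ℝ) (m : M) (hi : i ∈ I) (s : Set ℕ∞) :
    MeasurableSet[slicesSigma X h c I] {ω | sliceCount X h i m (c m i) ω ∈ s} :=
  le_iSup₂_of_le (f := fun (q : M × ℕ) (_ : q ∈ Prod.snd ⁻¹' I) =>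
    MeasurableSpace.comap (sliceCount X h q.2 q.1 (c q.1 q.2)) ⊤) (m, i) hi le_rfl _
    ⟨s, trivial, rfl⟩

namespace IsPoissonNoise

variable [MeasurableSpace Ω] {μ : Measure Ω} (hX : IsPoissonNoise X μ)

include hX

lemma countSigma_le (m : M) : countSigma (X m) ≤ ‹MeasurableSpace Ω› :=
  iSup_le fun B => measurable_iff_comap_le.1 ((hX.poisson m).measurable_count B.1 B.2)

lemma measurable_sliceCount (i : ℕ) (m : M) (c : ℝ) : Measurable (sliceCount X h i m c) :=
  (hX.poisson m).measurable_count _ (measurableSet_slice h i c)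

lemma slicesSigma_le : slicesSigma X h c I ≤ ‹MeasurableSpace Ω› :=
  iSup₂_le fun q _ => measurable_iff_comap_le.1 (hX.measurable_sliceCount q.2 q.1 _)

lemma map_sliceCount (hh : 0 ≤ h) (i : ℕ) (m : M) (c : ℝ) :
    μ.map (sliceCount X h i m c)
      = (poissonMeasure (h.toNNReal * c.toNNReal)).map (fun n : ℕ => (n : ℕ∞)) := by
  have hvol := volume_restrict_slice hh i c
  have hlaw := (hX.poisson m).law_count _ (measurableSet_slice h i c) (by rw [hvol]; finiteness)
  rwa [hvol, ENNReal.toNNReal_mul] at hlaw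

lemma measure_sliceCount_eq_one (hh : 0 ≤ h) (i : ℕ) (m : M) (c : ℝ) :
    μ {ω | sliceCount X h i m c ω = 1}
      = ENNReal.ofReal h * ENNReal.ofReal c * μ {ω | sliceCount X h i m c ω = 0} :=
  measure_count_eq_one (hX.measurable_sliceCount i m c) (hX.map_sliceCount hh i m c)

lemma measure_two_le_sliceCount_le (hh : 0 ≤ h) (i : ℕ) (m : M) (c : ℝ) :
    μ {ω | 2 ≤ sliceCount X h i m c ω} ≤ ENNReal.ofReal h ^ 2 * ENNReal.ofReal c ^ 2 :=
  (measure_two_le_count (hX.measurable_sliceCount i m c) (hX.map_sliceCount hh i m c)).trans_eq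
    (mul_pow (ENNReal.ofReal h) (ENNReal.ofReal c) 2)

lemma measure_one_le_sliceCount_inter_le (hh : 0 ≤ h) (i : ℕ) {m m' : M} (hne : m ≠ m')
    (c c' : ℝ) :
    μ ({ω | 1 ≤ sliceCount X h i m c ω} ∩ {ω | 1 ≤ sliceCount X h i m' c' ω})
      ≤ ENNReal.ofReal h ^ 2 * (ENNReal.ofReal c * ENNReal.ofReal c') := by
  have hone (m : M) (c : ℝ) :
      μ {ω | 1 ≤ sliceCount X h i m c ω} ≤ ENNReal.ofReal h * ENNReal.ofReal c :=
    measure_one_le_count (hX.measurable_sliceCount i m c) (hX.map_sliceCount hh i m c)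
  calc _ = μ {ω | 1 ≤ sliceCount X h i m c ω} * μ {ω | 1 ≤ sliceCount X h i m' c' ω} :=
        (Indep_iff _ _ μ).1 (hX.iIndep_countSigma.indep hne) _ _
          (measurableSet_countSigma_sliceCount m c (Set.Ici 1))
          (measurableSet_countSigma_sliceCount m' c' (Set.Ici 1))
    _ ≤ (ENNReal.ofReal h * ENNReal.ofReal c) * (ENNReal.ofReal h * ENNReal.ofReal c') := by
        gcongr <;> exact hone _ _
    _ = _ := by ring

lemma iIndepFun_sliceCount (hh : 0 ≤ h) (c : M → ℕ → ℝ) :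
    iIndepFun (fun (q : M × ℕ) ω => sliceCount X h q.2 q.1 (c q.1 q.2) ω) μ := by
  refine iIndepFun_uncurry' (X := fun m i ω => sliceCount X h i m (c m i) ω)
    (fun m i => hX.measurable_sliceCount i m _) ?_ fun m => ?_
  · rw [iIndepFun_iff_iIndep]
    refine iIndep_of_iIndep_of_le hX.iIndep_countSigma fun m => ?_
    rw [← measurable_iff_comap_le, @measurable_pi_iff]
    exact fun i => measurable_iff_comap_le.2 (comap_sliceCount_le_countSigma m (c m i))
  · rw [iIndepFun_iff_finset]
    intro s
    have e := s.equivFin.symm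
    refine iIndepFun.of_precomp (g := e) e.surjective ?_
    exact (hX.poisson m).indep_count s.card (fun k => slice h (e k) (c m (e k)))
      (fun k => measurableSet_slice _ _ _) fun k k' hkk =>
        disjoint_slice hh (fun he => hkk (e.injective (Subtype.ext he))) _ _

lemma indep_slicesSigma (hh : 0 ≤ h) (c : M → ℕ → ℝ) (hIJ : Disjoint I J) :
    Indep (slicesSigma X h c I) (slicesSigma X h c J) μ :=
  indep_iSup_of_disjoint
    (m := fun q : M × ℕ => MeasurableSpace.comap (sliceCount X h q.2 q.1 (c q.1 q.2)) ⊤)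
    (fun q => measurable_iff_comap_le.1 (hX.measurable_sliceCount q.2 q.1 (c q.1 q.2)))
    ((iIndepFun_iff_iIndep ..).1 (hX.iIndepFun_sliceCount hh c)) (hIJ.preimage Prod.snd)

lemma measure_exists_simultaneous_le {m m' : M} (hne : m ≠ m') {T : ℝ} (hT : 0 ≤ T) (c : ℝ)
    (n : ℕ) :
    μ {ω | ∃ r ∈ Set.Ioc 0 T, ∃ u ∈ Set.Ioo 0 c, ∃ u' ∈ Set.Ioo 0 c,
        (r, u) ∈ X m ω ∧ (r, u') ∈ X m' ω}
      ≤ (n + 1 : ℕ) * (ENNReal.ofReal (mesh T n) ^ 2 *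
        (ENNReal.ofReal c * ENNReal.ofReal c)) := by
  refine (measure_mono (t := ⋃ i ∈ Finset.range (n + 1),
    {ω | 1 ≤ sliceCount X (mesh T n) i m c ω} ∩ {ω | 1 ≤ sliceCount X (mesh T n) i m' c ω})
    ?_).trans ?_
  · rintro ω ⟨r, ⟨hr, hrT⟩, u, hu, u', hu', hmem, hmem'⟩
    obtain ⟨i, hi, hri⟩ := exists_mem_Ioc_slice hr (hrT.trans_eq (succ_mul_mesh T n).symm)
    exact Set.mem_biUnion (Finset.mem_coe.2 (Finset.mem_range.2 hi))
      ⟨one_le_sliceCount ⟨hmem, hri, hu⟩, one_le_sliceCount ⟨hmem', hri, hu'⟩⟩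
  · refine (measure_biUnion_finset_le _ _).trans ((Finset.sum_le_card_nsmul _ _ _ fun i _ =>
      hX.measure_one_le_sliceCount_inter_le (mesh_nonneg hT n) i hne c c).trans_eq ?_)
    rw [Finset.card_range, nsmul_eq_mul]

lemma ae_noSimultaneousPoints [Countable M] : ∀ᵐ ω ∂μ, NoSimultaneousPoints fun m => X m ω := by
  have hnull (m m' : M) (hne : m ≠ m') (N : ℕ) : ∀ᵐ ω ∂μ, ¬ ∃ r ∈ Set.Ioc (0 : ℝ) N,
      ∃ u ∈ Set.Ioo (0 : ℝ) N, ∃ u' ∈ Set.Ioo (0 : ℝ) N, (r, u) ∈ X m ω ∧ (r, u') ∈ X m' ω := by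
    rw [ae_iff]
    simp only [not_not]
    exact le_antisymm (ge_of_tendsto' (tendsto_succ_mul_mesh_sq N.cast_nonneg (by finiteness))
      (hX.measure_exists_simultaneous_le hne N.cast_nonneg N)) zero_le
  have hall : ∀ᵐ ω ∂μ, ∀ m m' : M, m ≠ m' → ∀ N : ℕ, _ :=
    ae_all_iff.2 fun m => ae_all_iff.2 fun m' => ae_all_iff.2 fun hne => ae_all_iff.2
      (hnull m m' hne)
  filter_upwards [hall] with ω hω m m' r u u' hr hu hu' hmem hmem'
  by_contra hne
  obtain ⟨N, hN⟩ := exists_nat_gt (max r (max u u'))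
  obtain ⟨hrN, huN, huN'⟩ := by simpa only [max_lt_iff] using hN
  exact hω m m' hne N ⟨r, ⟨hr, hrN.le⟩, u, ⟨hu, huN⟩, u', ⟨hu', huN'⟩, hmem, hmem'⟩

end IsPoissonNoise

end Noise

/-! ### The discretized dynamics -/

section Chain

variable {M S Ω : Type*}

/-- In the `i`-th slice a single point is below the rate of its mark in the state `z`, and its mark
is `m`. -/
def IsSoleMark (R : M → S → ℝ) (X : M → Ω → Set (ℝ × ℝ)) (h : ℝ) (i : ℕ) (z : S) (ω : Ω) (m : M) :
    Prop :=
  sliceCount X h i m (R m z) ω = 1 ∧ ∀ m' ≠ m, sliceCount X h i m' (R m' z) ω = 0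

open Classical in
/-- The mark of the single point of the `i`-th slice that is below the rate of its mark in the
state `z`, if there is just one such point. -/
noncomputable def sliceMark (R : M → S → ℝ) (X : M → Ω → Set (ℝ × ℝ)) (h : ℝ) (i : ℕ) (z : S)
    (ω : Ω) : Option M :=
  if hm : ∃ m, IsSoleMark R X h i z ω m then some hm.choose else none

/-- One step of the discretized dynamics: a transition, or none at all. -/
def applyMark (Γ : M → S → S) (o : Option M) (z : S) : S :=
  o.elim z fun m => Γ m z

/-- The state reached from `z` by a list of steps, the most recent one first. -/
def applyMarks (Γ : M → S → S) (z : S) (l : List (Option M)) : S :=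
  l.foldr (applyMark Γ) z

/-- The steps made by the discretized dynamics started from `z` in the first slices, the most recent
one first. Recording the steps rather than the states makes the event of a given history depend on a
single count per mark and slice. -/
noncomputable def history (Γ : M → S → S) (R : M → S → ℝ) (X : M → Ω → Set (ℝ × ℝ)) (h : ℝ) (z : S)
    (ω : Ω) : ℕ → List (Option M)
  | 0 => []
  | j + 1 => sliceMark R X h j (applyMarks Γ z (history Γ R X h z ω j)) ω :: history Γ R X h z ω j

/-- When the `i`-th slice is entered in the state `z`, there may be two transitions in it: besides a
point that triggers the transition `m`, there is a second one that is below the rate of its mark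
before or after this transition. -/
def IsBadSlice (Γ : M → S → S) (R : M → S → ℝ) (X : M → Ω → Set (ℝ × ℝ)) (h : ℝ) (i : ℕ) (z : S)
    (ω : Ω) : Prop :=
  ∃ m m' q q', (m, q) ≠ (m', q') ∧ q ∈ X m ω ∩ slice h i (R m z) ∧
    q' ∈ X m' ω ∩ slice h i (max (R m' z) (R m' (Γ m z)))

variable {Γ : M → S → S} {R : M → S → ℝ} {X : M → Ω → Set (ℝ × ℝ)} {h : ℝ} {i : ℕ} {z : S} {ω : Ω}
  {m : M}

lemma IsSoleMark.unique {m' : M} (hm : IsSoleMark R X h i z ω m)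
    (hm' : IsSoleMark R X h i z ω m') : m = m' := by
  by_contra hne
  exact one_ne_zero (hm.1.symm.trans (hm'.2 m hne))

lemma sliceMark_eq_some_iff : sliceMark R X h i z ω = some m ↔ IsSoleMark R X h i z ω m := by
  classical
  rw [sliceMark]
  split_ifs with hex
  · rw [Option.some_inj]
    exact ⟨fun hm => hm ▸ hex.choose_spec, fun hm => hex.choose_spec.unique hm⟩
  · exact iff_of_false not_false fun hm => hex ⟨m, hm⟩

lemma history_succ_eq_cons_iff {j : ℕ} {l : List (Option M)} {o : Option M} :
    history Γ R X h z ω (j + 1) = o :: l ↔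
      history Γ R X h z ω j = l ∧ sliceMark R X h j (applyMarks Γ z l) ω = o := by
  rw [history, List.cons.injEq, and_comm]
  exact and_congr_right fun hl => by rw [hl]

lemma mem_active_iff {r : ℝ} (hr : r ∈ Set.Ioc (i * h) ((i + 1) * h)) :
    m ∈ active R (fun m => X m ω) r z ↔ ∃ u, (r, u) ∈ X m ω ∩ slice h i (R m z) :=
  ⟨fun ⟨u, hu, hmem, hlt⟩ => ⟨u, hmem, hr, hu, hlt⟩,
    fun ⟨u, hmem, _, hu, hlt⟩ => ⟨u, hu, hmem, hlt⟩⟩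

lemma eq_of_not_isBadSlice (hbad : ¬ IsBadSlice Γ R X h i z ω) {q q' : ℝ × ℝ} {m' : M}
    (hq : q ∈ X m ω ∩ slice h i (R m z))
    (hq' : q' ∈ X m' ω ∩ slice h i (max (R m' z) (R m' (Γ m z)))) : m' = m ∧ q' = q := by
  by_contra hne
  exact hbad ⟨m, m', q, q', fun he => hne (Prod.mk.inj he.symm), hq, hq'⟩

lemma isSoleMark_of_not_isBadSlice (hbad : ¬ IsBadSlice Γ R X h i z ω) {q : ℝ × ℝ}
    (hq : q ∈ X m ω ∩ slice h i (R m z)) : IsSoleMark R X h i z ω m := by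
  have huniq {m' : M} {q' : ℝ × ℝ} (hq' : q' ∈ X m' ω ∩ slice h i (R m' z)) :
      m' = m ∧ q' = q :=
    eq_of_not_isBadSlice hbad hq ⟨hq'.1, slice_subset_slice h i (le_max_left _ _) hq'.2⟩
  refine ⟨Set.encard_eq_one.2 ⟨q, Set.eq_singleton_iff_unique_mem.2 ⟨hq, fun q' hq' =>
    (huniq hq').2⟩⟩, fun m' hne => Set.encard_eq_zero.2 (Set.eq_empty_of_forall_notMem ?_)⟩
  exact fun q' hq' => hne (huniq hq').1

lemma evolves_of_sliceMark_eq_none (hbad : ¬ IsBadSlice Γ R X h i z ω)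
    (hnone : sliceMark R X h i z ω = none) {t : ℝ} (ht : t ∈ Set.Icc (i * h) ((i + 1) * h)) :
    Evolves Γ R (fun m => X m ω) (i * h) z t z := by
  refine .rest ht.1 fun r hr hrt => Set.eq_empty_of_forall_notMem fun m hm => ?_
  obtain ⟨u, hu⟩ := (mem_active_iff ⟨hr, hrt.trans ht.2⟩).1 hm
  have hsome := sliceMark_eq_some_iff.2 (isSoleMark_of_not_isBadSlice hbad hu)
  exact Option.some_ne_none m (hsome.symm.trans hnone)

lemma exists_active_of_sliceMark_eq_some (hbad : ¬ IsBadSlice Γ R X h i z ω)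
    (hsome : sliceMark R X h i z ω = some m) :
    ∃ r ∈ Set.Ioc (i * h) ((i + 1) * h),
      (∀ r', i * h < r' → r' < r → active R (fun m => X m ω) r' z = ∅) ∧
      active R (fun m => X m ω) r z = {m} ∧
      ∀ r', r < r' → r' ≤ (i + 1) * h → active R (fun m => X m ω) r' (Γ m z) = ∅ := by
  obtain ⟨⟨r, u⟩, hru⟩ := Set.encard_eq_one.1 (sliceMark_eq_some_iff.1 hsome).1
  have hmem : (r, u) ∈ X m ω ∩ slice h i (R m z) := hru ▸ Set.mem_singleton _
  have hr : r ∈ Set.Ioc (i * h) ((i + 1) * h) := hmem.2.1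
  have huniq (r' : ℝ) (hr' : r' ∈ Set.Ioc (i * h) ((i + 1) * h)) (m' : M) (w : S)
      (hw : R m' w ≤ max (R m' z) (R m' (Γ m z)))
      (hm' : m' ∈ active R (fun m => X m ω) r' w) : m' = m ∧ r' = r := by
    obtain ⟨u', hu'⟩ := (mem_active_iff hr').1 hm'
    obtain ⟨hm, hq⟩ := eq_of_not_isBadSlice hbad hmem ⟨hu'.1, slice_subset_slice h i hw hu'.2⟩
    exact ⟨hm, congrArg Prod.fst hq⟩
  refine ⟨r, hr, fun r' h1 h2 => ?_, ?_, fun r' h1 h2 => ?_⟩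
  · exact Set.eq_empty_of_forall_notMem fun m' hm' =>
      h2.ne (huniq r' ⟨h1, h2.le.trans hr.2⟩ m' z (le_max_left _ _) hm').2
  · exact Set.eq_singleton_iff_unique_mem.2 ⟨(mem_active_iff hr).2 ⟨u, hmem⟩, fun m' hm' =>
      (huniq r hr m' z (le_max_left _ _) hm').1⟩
  · exact Set.eq_empty_of_forall_notMem fun m' hm' =>
      h1.ne' (huniq r' ⟨hr.1.trans h1, h2⟩ m' (Γ m z) (le_max_right _ _) hm').2

lemma exists_evolves_of_not_isBadSlice (hbad : ¬ IsBadSlice Γ R X h i z ω) {t : ℝ}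
    (ht : t ∈ Set.Icc (i * h) ((i + 1) * h)) :
    ∃ w, (w = z ∨ w = applyMark Γ (sliceMark R X h i z ω) z) ∧
      (t = (i + 1) * h → w = applyMark Γ (sliceMark R X h i z ω) z) ∧
      Evolves Γ R (fun m => X m ω) (i * h) z t w := by
  cases hs : sliceMark R X h i z ω with
  | none => exact ⟨z, .inl rfl, fun _ => rfl, evolves_of_sliceMark_eq_none hbad hs ht⟩
  | some m =>
    obtain ⟨r, hr, quiet, hact, quiet'⟩ := exists_active_of_sliceMark_eq_some hbad hs
    rcases lt_or_ge t r with htr | hrt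
    · exact ⟨z, .inl rfl, fun he => absurd (htr.trans_le hr.2) he.not_lt,
        .rest ht.1 fun r' h1 h2 => quiet r' h1 (h2.trans_lt htr)⟩
    · exact ⟨Γ m z, .inr rfl, fun _ => rfl,
        .jump hr.1 hrt quiet hact (.rest hrt fun r' h1 h2 => quiet' r' h1 (h2.trans ht.2))⟩

lemma evolves_history (hh : 0 ≤ h) (z : S) (n : ℕ)
    (hbad : ∀ i < n, ¬ IsBadSlice Γ R X h i (applyMarks Γ z (history Γ R X h z ω i)) ω) :
    Evolves Γ R (fun m => X m ω) 0 z (n * h) (applyMarks Γ z (history Γ R X h z ω n)) := by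
  induction n with
  | zero => exact .rest (by simp) fun r h0 hr => absurd h0 (by simpa using hr)
  | succ n ih =>
    have hle : n * h ≤ (n + 1) * h := by nlinarith
    obtain ⟨w, -, hw, hev⟩ :=
      exists_evolves_of_not_isBadSlice (hbad n n.lt_succ_self) (Set.right_mem_Icc.2 hle)
    rw [hw rfl] at hev
    push_cast
    exact (ih fun i hi => hbad i (hi.trans n.lt_succ_self)).trans hev

lemma exists_evolves_history (hh : 0 ≤ h) (z : S) (n : ℕ)
    (hbad : ∀ i < n, ¬ IsBadSlice Γ R X h i (applyMarks Γ z (history Γ R X h z ω i)) ω) {t : ℝ}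
    (ht : t ∈ Set.Icc 0 (n * h)) :
    ∃ j ≤ n, Evolves Γ R (fun m => X m ω) 0 z t (applyMarks Γ z (history Γ R X h z ω j)) := by
  rcases ht.1.eq_or_lt with rfl | h0
  · exact ⟨0, n.zero_le, .rest le_rfl fun r h0 hr => absurd h0 hr.not_gt⟩
  obtain ⟨i, hi, hti⟩ := exists_mem_Ioc_slice h0 ht.2
  obtain ⟨w, hw, -, hev⟩ :=
    exists_evolves_of_not_isBadSlice (hbad i hi) (Set.Ioc_subset_Icc_self hti)
  have hev' := (evolves_history hh z i fun k hk => hbad k (hk.trans hi)).trans hev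
  rcases hw with rfl | rfl
  · exact ⟨i, hi.le, hev'⟩
  · exact ⟨i + 1, hi, hev'⟩

section Measurability

variable [Countable M]

lemma measurableSet_sliceMark {c : M → ℕ → ℝ} {I : Set ℕ} (hi : i ∈ I) (hc : ∀ m, c m i = R m z)
    (o : Option M) : MeasurableSet[slicesSigma X h c I] {ω | sliceMark R X h i z ω = o} := by
  have hcount (m : M) (s : Set ℕ∞) :
      MeasurableSet[slicesSigma X h c I] {ω | sliceCount X h i m (R m z) ω ∈ s} := by
    simpa only [hc] using measurableSet_slicesSigma_sliceCount c m hi s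
  have hsome (m : M) : MeasurableSet[slicesSigma X h c I] {ω | sliceMark R X h i z ω = some m} := by
    simp only [sliceMark_eq_some_iff, IsSoleMark, Set.ofPred_and, Set.ofPred_forall]
    exact (hcount m {1}).inter (.iInter fun m' => .iInter fun _ => hcount m' {0})
  cases o with
  | some m => exact hsome m
  | none =>
    simp only [Option.eq_none_iff_forall_ne_some, Set.ofPred_forall]
    exact .iInter fun m => (hsome m).compl

lemma exists_measurableSet_history (Γ : M → S → S) (z : S) (j : ℕ) (l : List (Option M)) :
    ∃ c : M → ℕ → ℝ,
      MeasurableSet[slicesSigma X h c (Set.Iio j)] {ω | history Γ R X h z ω j = l} := by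
  induction j generalizing l with
  | zero => exact ⟨fun _ _ => 0, .const ([] = l)⟩
  | succ j ih =>
    cases l with
    | nil => exact ⟨fun _ _ => 0, by simp [history]⟩
    | cons o l =>
      obtain ⟨c, hc⟩ := ih l
      set c' : M → ℕ → ℝ := fun m i => if i < j then c m i else R m (applyMarks Γ z l)
      have hpast : ∀ m, ∀ i ∈ Set.Iio j, c m i = c' m i := fun m i hi => (if_pos hi).symm
      rw [slicesSigma_congr hpast] at hc
      refine ⟨c', ?_⟩
      simp only [history_succ_eq_cons_iff, Set.ofPred_and]
      exact (slicesSigma_mono (Set.Iio_subset_Iio j.le_succ) _ hc).inter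
        (measurableSet_sliceMark (Set.mem_Iio.2 j.lt_succ_self) (fun m => if_neg (lt_irrefl j)) o)

namespace IsPoissonNoise

variable [MeasurableSpace Ω] {μ : Measure Ω} (hX : IsPoissonNoise X μ)

include hX

lemma measurableSet_history (Γ : M → S → S) (z : S) (j : ℕ) (l : List (Option M)) :
    MeasurableSet {ω | history Γ R X h z ω j = l} := by
  obtain ⟨c, hc⟩ := exists_measurableSet_history (X := X) (R := R) (h := h) Γ z j l
  exact hX.slicesSigma_le _ hc

lemma measurableSet_sliceMark (i : ℕ) (z : S) (o : Option M) :
    MeasurableSet {ω | sliceMark R X h i z ω = o} :=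
  hX.slicesSigma_le (c := fun m _ => R m z) _
    (ReactionDiffusion.measurableSet_sliceMark (Set.mem_univ i) (fun _ => rfl) o)

lemma measure_history_inter (hh : 0 ≤ h) (Γ : M → S → S) (z : S) (j : ℕ) (l : List (Option M))
    (c : M → ℕ → ℝ) {A : Set Ω} (hA : MeasurableSet[slicesSigma X h c {j}] A) :
    μ ({ω | history Γ R X h z ω j = l} ∩ A) = μ {ω | history Γ R X h z ω j = l} * μ A := by
  obtain ⟨c₀, hc₀⟩ := exists_measurableSet_history (X := X) (R := R) (h := h) Γ z j l
  set c' : M → ℕ → ℝ := fun m i => if i < j then c₀ m i else c m i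
  have hpast : ∀ m, ∀ i ∈ Set.Iio j, c₀ m i = c' m i := fun m i hi => (if_pos hi).symm
  have hnext : ∀ m, ∀ i ∈ ({j} : Set ℕ), c m i = c' m i := fun m i hi =>
    (if_neg (Set.mem_singleton_iff.1 hi).not_lt).symm
  rw [slicesSigma_congr hpast] at hc₀
  rw [slicesSigma_congr hnext] at hA
  exact (Indep_iff _ _ μ).1 (hX.indep_slicesSigma hh c' (by simp)) _ _ hc₀ hA

end IsPoissonNoise

end Measurability

end Chain

/-! ### Estimates for the discretized dynamics -/

section CountablyValued

variable {Ω L : Type*} [MeasurableSpace Ω] {μ : Measure Ω} [Countable L] {Y : Ω → L}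

lemma measurable_comp_of_countable (hY : ∀ l, MeasurableSet {ω | Y ω = l}) (f : L → ℝ≥0∞) :
    Measurable fun ω => f (Y ω) :=
  let _ : MeasurableSpace L := ⊤
  (measurable_from_top (f := f)).comp (measurable_to_countable' hY)

lemma lintegral_comp_of_countable (hY : ∀ l, MeasurableSet {ω | Y ω = l}) (f : L → ℝ≥0∞) :
    ∫⁻ ω, f (Y ω) ∂μ = ∑' l, μ {ω | Y ω = l} * f l := by
  let _ : MeasurableSpace L := ⊤
  have : DiscreteMeasurableSpace L := ⟨fun _ => trivial⟩
  have hYm : Measurable Y := measurable_to_countable' hY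
  rw [← lintegral_map .of_discrete hYm, lintegral_countable']
  refine tsum_congr fun l => ?_
  rw [Measure.map_apply hYm (measurableSet_singleton l), mul_comm]
  rfl

lemma tsum_measure_fiber [IsProbabilityMeasure μ] (hY : ∀ l, MeasurableSet {ω | Y ω = l}) :
    ∑' l, μ {ω | Y ω = l} = 1 := by
  simpa only [lintegral_const, measure_univ, mul_one, one_mul]
    using (lintegral_comp_of_countable (μ := μ) hY fun _ => 1).symm

end CountablyValued

lemma tsum_option {β : Type*} (f : Option β → ℝ≥0∞) :
    ∑' o, f o = f none + ∑' b, f (some b) := by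
  rw [← (Equiv.optionEquivSumPUnit.{0} β).symm.tsum_eq, Summable.tsum_sum ENNReal.summable
    ENNReal.summable, add_comm]
  simp

section Drift

variable {M S : Type*}

/-- The total rate of the transitions out of the state `z`. -/
noncomputable def totalRate (R : M → S → ℝ) (z : S) : ℝ≥0∞ :=
  ∑' m, ENNReal.ofReal (R m z)

/-- `f` grows at most at the exponential rate `c` in expectation along the dynamics in `I`: the
generator satisfies `L f ≤ c * f` on `I`, here with the loss term of `L` on the right-hand side. -/
def HasDriftBound (Γ : M → S → S) (R : M → S → ℝ) (I : Set S) (c : ℝ≥0∞) (f : S → ℝ≥0∞) : Prop :=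
  ∀ z ∈ I, ∑' m, ENNReal.ofReal (R m z) * f (Γ m z) ≤ (totalRate R z + c) * f z

/-- Up to the factor `h ^ 2`, a bound for the probability that a slice of length `h` which is
entered in the state `z` is bad. -/
noncomputable def pairRate (Γ : M → S → S) (R : M → S → ℝ) (z : S) : ℝ≥0∞ :=
  ∑' m, (ENNReal.ofReal (R m z) * ∑' m', ENNReal.ofReal (max (R m' z) (R m' (Γ m z))) +
    (if 0 < R m z then ENNReal.ofReal (max (R m z) (R m (Γ m z))) else 0) ^ 2)

/-- The value of `f` along a list of steps from `z`, stopped when it exceeds `A`. -/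
noncomputable def stoppedValue (Γ : M → S → S) (f : S → ℝ≥0∞) (A : ℝ≥0∞) (z : S) :
    List (Option M) → ℝ≥0∞
  | [] => f z
  | o :: l =>
    if A < stoppedValue Γ f A z l then stoppedValue Γ f A z l else f (applyMarks Γ z (o :: l))

variable {Γ : M → S → S} {R : M → S → ℝ} {I : Set S} {z : S}

lemma applyMarks_mem (hI : ∀ m, Set.MapsTo (Γ m) I I) (hz : z ∈ I) (l : List (Option M)) :
    applyMarks Γ z l ∈ I := by
  induction l with
  | nil => exact hz
  | cons o l ih =>
    cases o with
    | none => exact ih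
    | some m => exact hI m ih

lemma stoppedValue_eq {f : S → ℝ≥0∞} {A : ℝ≥0∞} {l : List (Option M)}
    (hl : ¬ A < stoppedValue Γ f A z l) : stoppedValue Γ f A z l = f (applyMarks Γ z l) := by
  cases l with
  | nil => rfl
  | cons o l =>
    rw [stoppedValue] at hl ⊢
    split_ifs at hl ⊢ with hlt
    · exact absurd hlt hl
    · rfl

lemma lt_stoppedValue_history {Ω : Type*} {X : M → Ω → Set (ℝ × ℝ)} {h : ℝ} {f : S → ℝ≥0∞}
    {A : ℝ≥0∞} {ω : Ω} {i j : ℕ} (hij : i ≤ j)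
    (hi : A < f (applyMarks Γ z (history Γ R X h z ω i))) :
    A < stoppedValue Γ f A z (history Γ R X h z ω j) := by
  induction j, hij using Nat.le_induction with
  | base =>
    by_contra hlt
    exact hlt (by rwa [stoppedValue_eq hlt])
  | succ j _ ih =>
    rw [history, stoppedValue, if_pos ih]
    exact ih

end Drift

namespace IsPoissonNoise

variable {M S Ω : Type*} {Γ : M → S → S} {R : M → S → ℝ} {X : M → Ω → Set (ℝ × ℝ)} {h : ℝ}
  {I : Set S} {z : S} {c : ℝ≥0∞} {f : S → ℝ≥0∞} [Countable M] [MeasurableSpace Ω] {μ : Measure Ω}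
  (hX : IsPoissonNoise X μ)

include hX

section OneStep

lemma measure_sliceMark_eq_some (hh : 0 ≤ h) (i : ℕ) (z : S) (m : M) :
    μ {ω | sliceMark R X h i z ω = some m} = ENNReal.ofReal h * ENNReal.ofReal (R m z) *
      μ {ω | ∀ m, sliceCount X h i m (R m z) ω = 0} := by
  set B : Set Ω := ⋂ m' ∈ ({m}ᶜ : Set M), {ω | sliceCount X h i m' (R m' z) ω ∈ ({0} : Set ℕ∞)}
  have hB : MeasurableSet[⨆ m' ∈ ({m}ᶜ : Set M), countSigma (X m')] B :=
    .biInter (Set.to_countable _) fun m' hm' =>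
      le_iSup₂ (f := fun m' (_ : m' ∈ ({m}ᶜ : Set M)) => countSigma (X m')) m' hm' _
        (measurableSet_countSigma_sliceCount m' _ _)
  have hind (k : ℕ∞) : μ ({ω | sliceCount X h i m (R m z) ω = k} ∩ B)
      = μ {ω | sliceCount X h i m (R m z) ω = k} * μ B := by
    have := indep_iSup_of_disjoint hX.countSigma_le hX.iIndep_countSigma
      (disjoint_compl_right (a := ({m} : Set M)))
    rw [iSup_singleton] at this
    exact (Indep_iff _ _ μ).1 this _ _ (measurableSet_countSigma_sliceCount m _ {k}) hB
  have hsome : {ω | sliceMark R X h i z ω = some m}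
      = {ω | sliceCount X h i m (R m z) ω = 1} ∩ B := by
    ext ω
    simp [sliceMark_eq_some_iff, IsSoleMark, B]
  have hnone : {ω | ∀ m, sliceCount X h i m (R m z) ω = 0}
      = {ω | sliceCount X h i m (R m z) ω = 0} ∩ B := by
    ext ω
    simp only [Set.mem_singleton_iff, Set.mem_compl_iff, Set.mem_inter_iff, Set.mem_iInter,
      Set.mem_ofPred_eq, B]
    exact ⟨fun h0 => ⟨h0 m, fun m' _ => h0 m'⟩, fun ⟨hm, h0⟩ m' =>
      (eq_or_ne m' m).elim (fun he => he ▸ hm) (h0 m')⟩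
  rw [hsome, hnone, hind, hind, hX.measure_sliceCount_eq_one hh, mul_assoc]

variable [IsProbabilityMeasure μ]

lemma tsum_measure_sliceMark_mul_le (hh : 0 ≤ h) (hf : HasDriftBound Γ R I c f) (hz : z ∈ I)
    (i : ℕ) :
    ∑' o, μ {ω | sliceMark R X h i z ω = o} * f (applyMark Γ o z)
      ≤ (1 + ENNReal.ofReal h * c) * f z := by
  set Q := μ {ω | ∀ m, sliceCount X h i m (R m z) ω = 0}
  have hone := tsum_measure_fiber (μ := μ) (hX.measurableSet_sliceMark (R := R) (h := h) i z)
  have hsome (m : M) : μ {ω | sliceMark R X h i z ω = some m} =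
      ENNReal.ofReal h * Q * ENNReal.ofReal (R m z) := by
    rw [hX.measure_sliceMark_eq_some hh, mul_right_comm]
  rw [tsum_option] at hone ⊢
  simp only [hsome, applyMark, Option.elim_none, Option.elim_some, mul_assoc (ENNReal.ofReal h * Q),
    ENNReal.tsum_mul_left] at hone ⊢
  set P₀ := μ {ω | sliceMark R X h i z ω = none}
  calc P₀ * f z + ENNReal.ofReal h * Q * ∑' m, ENNReal.ofReal (R m z) * f (Γ m z)
      ≤ P₀ * f z + ENNReal.ofReal h * Q * ((totalRate R z + c) * f z) := by
        gcongr
        exact hf z hz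
    _ = (P₀ + ENNReal.ofReal h * Q * totalRate R z) * f z + ENNReal.ofReal h * Q * c * f z := by
        ring
    _ ≤ 1 * f z + ENNReal.ofReal h * 1 * c * f z := by
        gcongr
        · exact hone.le
        · exact prob_le_one
    _ = _ := by ring

end OneStep

section Expectation

lemma measure_history_succ (hh : 0 ≤ h) (z : S) (j : ℕ) (l : List (Option M)) (o : Option M) :
    μ {ω | history Γ R X h z ω (j + 1) = o :: l} = μ {ω | history Γ R X h z ω j = l} *
      μ {ω | sliceMark R X h j (applyMarks Γ z l) ω = o} := by
  simp only [history_succ_eq_cons_iff, Set.ofPred_and]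
  exact hX.measure_history_inter hh Γ z j l (fun m _ => R m (applyMarks Γ z l))
    (ReactionDiffusion.measurableSet_sliceMark (Set.mem_singleton j) (fun _ => rfl) o)

variable {g : List (Option M) → ℝ≥0∞} {κ : ℝ≥0∞}

lemma lintegral_history_succ_le (hh : 0 ≤ h) (z : S) (j : ℕ)
    (hg : ∀ l, ∑' o, μ {ω | sliceMark R X h j (applyMarks Γ z l) ω = o} * g (o :: l) ≤ κ * g l) :
    ∫⁻ ω, g (history Γ R X h z ω (j + 1)) ∂μ ≤ κ * ∫⁻ ω, g (history Γ R X h z ω j) ∂μ := by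
  have hcons : Function.Injective fun q : List (Option M) × Option M => q.2 :: q.1 :=
    fun q q' he => Prod.ext (List.cons.inj he).2 (List.cons.inj he).1
  rw [lintegral_comp_of_countable (hX.measurableSet_history Γ z j),
    lintegral_comp_of_countable (hX.measurableSet_history Γ z (j + 1)), ← hcons.tsum_eq,
    ENNReal.tsum_prod', ← ENNReal.tsum_mul_left]
  · refine ENNReal.tsum_le_tsum fun l => ?_
    simp only [hX.measure_history_succ hh, mul_assoc, ENNReal.tsum_mul_left]
    rw [mul_left_comm]
    gcongr
    exact hg l
  · rintro (- | ⟨o, l⟩) hl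
    · simp [history] at hl
    · exact ⟨(l, o), rfl⟩

variable [IsProbabilityMeasure μ]

lemma lintegral_history_le (hh : 0 ≤ h) (z : S)
    (hg : ∀ j l,
      ∑' o, μ {ω | sliceMark R X h j (applyMarks Γ z l) ω = o} * g (o :: l) ≤ κ * g l) (j : ℕ) :
    ∫⁻ ω, g (history Γ R X h z ω j) ∂μ ≤ κ ^ j * g [] := by
  induction j with
  | zero => simp [history]
  | succ j ih =>
    refine (hX.lintegral_history_succ_le hh z j (hg j)).trans ?_
    rw [pow_succ', mul_assoc]
    gcongr

lemma lintegral_applyMarks_history_le (hh : 0 ≤ h) (hf : HasDriftBound Γ R I c f)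
    (hI : ∀ m, Set.MapsTo (Γ m) I I) (hz : z ∈ I) (j : ℕ) :
    ∫⁻ ω, f (applyMarks Γ z (history Γ R X h z ω j)) ∂μ ≤ (1 + ENNReal.ofReal h * c) ^ j * f z :=
  hX.lintegral_history_le (g := fun l => f (applyMarks Γ z l)) hh z
    (fun j l => hX.tsum_measure_sliceMark_mul_le hh hf (applyMarks_mem hI hz l) j) j

lemma lintegral_stoppedValue_history_le (hh : 0 ≤ h) (hf : HasDriftBound Γ R I c f)
    (hI : ∀ m, Set.MapsTo (Γ m) I I) (hz : z ∈ I) (A : ℝ≥0∞) (j : ℕ) :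
    ∫⁻ ω, stoppedValue Γ f A z (history Γ R X h z ω j) ∂μ
      ≤ (1 + ENNReal.ofReal h * c) ^ j * f z := by
  refine hX.lintegral_history_le (g := stoppedValue Γ f A z) hh z (fun j l => ?_) j
  simp only [stoppedValue]
  split_ifs with hl
  · rw [ENNReal.tsum_mul_right, tsum_measure_fiber (hX.measurableSet_sliceMark j _)]
    gcongr
    exact le_self_add
  · rw [stoppedValue_eq hl]
    exact hX.tsum_measure_sliceMark_mul_le hh hf (applyMarks_mem hI hz l) j

lemma measure_exists_lt_history_le (hh : 0 ≤ h) (hf : HasDriftBound Γ R I c f)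
    (hI : ∀ m, Set.MapsTo (Γ m) I I) (hz : z ∈ I) {A : ℝ≥0∞} (hA : A ≠ 0) (hA' : A ≠ ∞) (j : ℕ) :
    μ {ω | ∃ i ≤ j, A < f (applyMarks Γ z (history Γ R X h z ω i))}
      ≤ (1 + ENNReal.ofReal h * c) ^ j * f z / A :=
  calc _ ≤ μ {ω | A ≤ stoppedValue Γ f A z (history Γ R X h z ω j)} :=
        by
        refine measure_mono ?_
        rintro ω ⟨i, hij, hi⟩
        exact (lt_stoppedValue_history hij hi).le
    _ ≤ (∫⁻ ω, stoppedValue Γ f A z (history Γ R X h z ω j) ∂μ) / A :=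
        meas_ge_le_lintegral_div (measurable_comp_of_countable
          (hX.measurableSet_history Γ z j) _).aemeasurable hA hA'
    _ ≤ _ := by
        gcongr
        exact hX.lintegral_stoppedValue_history_le hh hf hI hz A j

end Expectation

section BadSlices

lemma measure_history_inter_one_le_le (hh : 0 ≤ h) (z : S) (j : ℕ) (l : List (Option M)) {m m' : M}
    (hne : m ≠ m') (a b : ℝ) :
    μ ({ω | history Γ R X h z ω j = l} ∩
        ({ω | 1 ≤ sliceCount X h j m a ω} ∩ {ω | 1 ≤ sliceCount X h j m' b ω}))
      ≤ μ {ω | history Γ R X h z ω j = l} *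
        (ENNReal.ofReal h ^ 2 * (ENNReal.ofReal a * ENNReal.ofReal b)) := by
  classical
  set c : M → ℕ → ℝ := fun k _ => if k = m then a else b
  have hm : c m j = a := if_pos rfl
  have hm' : c m' j = b := if_neg hne.symm
  have hone (m : M) : MeasurableSet[slicesSigma X h c {j}] {ω | 1 ≤ sliceCount X h j m (c m j) ω} :=
    measurableSet_slicesSigma_sliceCount c m (Set.mem_singleton j) (Set.Ici 1)
  rw [hX.measure_history_inter hh Γ z j l c (hm ▸ hm' ▸ (hone m).inter (hone m'))]
  gcongr
  exact hX.measure_one_le_sliceCount_inter_le hh j hne a b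

lemma measure_history_inter_two_le_le (hh : 0 ≤ h) (z : S) (j : ℕ) (l : List (Option M)) (m : M)
    (a : ℝ) :
    μ ({ω | history Γ R X h z ω j = l} ∩ {ω | 2 ≤ sliceCount X h j m a ω})
      ≤ μ {ω | history Γ R X h z ω j = l} * (ENNReal.ofReal h ^ 2 * ENNReal.ofReal a ^ 2) := by
  have htwo : MeasurableSet[slicesSigma X h (fun _ _ => a) {j}] {ω | 2 ≤ sliceCount X h j m a ω} :=
    measurableSet_slicesSigma_sliceCount _ m (Set.mem_singleton j) (Set.Ici 2)
  rw [hX.measure_history_inter hh Γ z j l _ htwo]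
  gcongr
  exact hX.measure_two_le_sliceCount_le hh j m a

lemma measure_history_inter_isBadSlice_le (hh : 0 ≤ h) (z : S) (j : ℕ) (l : List (Option M))
    (y : S) :
    μ ({ω | history Γ R X h z ω j = l} ∩ {ω | IsBadSlice Γ R X h j y ω})
      ≤ μ {ω | history Γ R X h z ω j = l} * (ENNReal.ofReal h ^ 2 * pairRate Γ R y) := by
  set H := {ω | history Γ R X h z ω j = l}
  set b : M → M → ℝ := fun m m' => max (R m' y) (R m' (Γ m y))
  have hsub : H ∩ {ω | IsBadSlice Γ R X h j y ω} ⊆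
      ⋃ m, (⋃ m', {_ω | m ≠ m'} ∩ (H ∩ ({ω | 1 ≤ sliceCount X h j m (R m y) ω} ∩
        {ω | 1 ≤ sliceCount X h j m' (b m m') ω}))) ∪
        ({_ω | 0 < R m y} ∩ (H ∩ {ω | 2 ≤ sliceCount X h j m (b m m) ω})) := by
    rintro ω ⟨hω, m, m', q, q', hne, hq, hq'⟩
    refine Set.mem_iUnion.2 ⟨m, ?_⟩
    rcases eq_or_ne m m' with rfl | hmm
    · exact .inr ⟨hq.2.2.1.trans hq.2.2.2, hω, two_le_sliceCount (fun he => hne (by rw [he]))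
        ⟨hq.1, slice_subset_slice h j (le_max_left _ _) hq.2⟩ hq'⟩
    · exact .inl (Set.mem_iUnion.2 ⟨m', hmm, hω, one_le_sliceCount hq, one_le_sliceCount hq'⟩)
  rw [pairRate, ← ENNReal.tsum_mul_left, ← ENNReal.tsum_mul_left]
  refine (measure_mono hsub).trans ((measure_iUnion_le _).trans (ENNReal.tsum_le_tsum fun m => ?_))
  simp only [mul_add, ← ENNReal.tsum_mul_left]
  refine (measure_union_le _ _).trans (add_le_add ((measure_iUnion_le _).trans
    (ENNReal.tsum_le_tsum fun m' => ?_)) ?_)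
  · by_cases hne : m = m'
    · simp [hne]
    · exact (measure_mono Set.inter_subset_right).trans
        (hX.measure_history_inter_one_le_le hh z j l hne _ _)
  · split_ifs with hm
    · exact (measure_mono Set.inter_subset_right).trans
        (hX.measure_history_inter_two_le_le hh z j l m _)
    · simp [hm]

variable [IsProbabilityMeasure μ] {B : Set S} {D : ℝ≥0∞}

lemma measure_isBadSlice_history_le (hh : 0 ≤ h) (z : S) (j : ℕ)
    (hD : ∀ y ∈ B, pairRate Γ R y ≤ D) :
    μ {ω | applyMarks Γ z (history Γ R X h z ω j) ∈ B ∧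
        IsBadSlice Γ R X h j (applyMarks Γ z (history Γ R X h z ω j)) ω}
      ≤ ENNReal.ofReal h ^ 2 * D := by
  set H : List (Option M) → Set Ω := fun l => {ω | history Γ R X h z ω j = l}
  calc _ ≤ μ (⋃ l, {_ω | applyMarks Γ z l ∈ B} ∩
          (H l ∩ {ω | IsBadSlice Γ R X h j (applyMarks Γ z l) ω})) :=
        measure_mono fun ω hω => Set.mem_iUnion.2 ⟨_, hω.1, rfl, hω.2⟩
    _ ≤ ∑' l, μ (H l) * (ENNReal.ofReal h ^ 2 * D) := by
        refine (measure_iUnion_le _).trans (ENNReal.tsum_le_tsum fun l => ?_)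
        by_cases hl : applyMarks Γ z l ∈ B
        · refine (measure_mono Set.inter_subset_right).trans
            ((hX.measure_history_inter_isBadSlice_le hh z j l _).trans ?_)
          gcongr
          exact hD _ hl
        · simp [hl]
    _ = _ := by
        rw [ENNReal.tsum_mul_right, tsum_measure_fiber (hX.measurableSet_history Γ z j), one_mul]

lemma measure_exists_isBadSlice_history_le (hh : 0 ≤ h) (z : S) (n : ℕ)
    (hD : ∀ y ∈ B, pairRate Γ R y ≤ D) :
    μ {ω | ∃ i < n, IsBadSlice Γ R X h i (applyMarks Γ z (history Γ R X h z ω i)) ω}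
      ≤ μ {ω | ∃ i ≤ n, applyMarks Γ z (history Γ R X h z ω i) ∉ B}
        + n * (ENNReal.ofReal h ^ 2 * D) := by
  have hsub : {ω | ∃ i < n, IsBadSlice Γ R X h i (applyMarks Γ z (history Γ R X h z ω i)) ω} ⊆
      {ω | ∃ i ≤ n, applyMarks Γ z (history Γ R X h z ω i) ∉ B} ∪
      ⋃ i ∈ Finset.range n, {ω | applyMarks Γ z (history Γ R X h z ω i) ∈ B ∧
        IsBadSlice Γ R X h i (applyMarks Γ z (history Γ R X h z ω i)) ω} := by
    rintro ω ⟨i, hi, hbad⟩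
    by_cases hB : applyMarks Γ z (history Γ R X h z ω i) ∈ B
    · exact .inr (Set.mem_biUnion (Finset.mem_coe.2 (Finset.mem_range.2 hi)) ⟨hB, hbad⟩)
    · exact .inl ⟨i, hi.le, hB⟩
  refine (measure_mono hsub).trans ((measure_union_le _ _).trans ?_)
  gcongr
  refine (measure_biUnion_finset_le _ _).trans ((Finset.sum_le_card_nsmul _ _ _ fun i _ =>
    hX.measure_isBadSlice_history_le hh z i hD).trans_eq ?_)
  rw [Finset.card_range, nsmul_eq_mul]

end BadSlices

end IsPoissonNoise

/-! ### Refinement of the discretization -/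

lemma one_add_mesh_mul_pow_le_exp {T : ℝ} (hT : 0 ≤ T) (c : ℝ≥0) (n : ℕ) :
    (1 + ENNReal.ofReal (mesh T n) * c) ^ (n + 1) ≤ ENNReal.ofReal (Real.exp (c * T)) := by
  have hh := mesh_nonneg hT n
  rw [← ENNReal.ofReal_coe_nnreal, ← ENNReal.ofReal_mul hh, ← ENNReal.ofReal_one,
    ← ENNReal.ofReal_add zero_le_one (by positivity), ← ENNReal.ofReal_pow (by positivity)]
  refine ENNReal.ofReal_le_ofReal ?_
  calc (1 + mesh T n * c) ^ (n + 1) ≤ Real.exp (mesh T n * c) ^ (n + 1) := by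
        gcongr
        rw [add_comm]
        exact Real.add_one_le_exp _
    _ = Real.exp (c * T) := by
        rw [← Real.exp_nat_mul, ← mul_assoc, succ_mul_mesh, mul_comm]

lemma tendsto_div_natCast_succ {E : ℝ≥0∞} (hE : E ≠ ∞) :
    Tendsto (fun K : ℕ => E / ((K + 1 : ℕ) : ℝ≥0∞)) atTop (𝓝 0) := by
  have hlim := (ENNReal.Tendsto.const_mul ENNReal.tendsto_inv_nat_nhds_zero (.inr hE)).comp
    (tendsto_add_atTop_nat 1)
  rwa [mul_zero] at hlim

section VanishingEvents

variable {Ω : Type*} [MeasurableSpace Ω] {μ : Measure Ω} {s : ℕ → Set Ω} {f : Ω → ℝ≥0∞}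
  {g : ℕ → Ω → ℝ≥0∞}

lemma exists_seq_ae_eventually_notMem (hs : Tendsto (fun n => μ (s n)) atTop (𝓝 0)) :
    ∃ ns : ℕ → ℕ, ∀ᵐ ω ∂μ, ∀ᶠ k in atTop, ω ∉ s (ns k) := by
  have hex (k : ℕ) : ∃ n, μ (s n) ≤ 2⁻¹ ^ k :=
    (ENNReal.tendsto_nhds_zero.1 hs _
      (ENNReal.pow_pos (ENNReal.inv_pos.2 ENNReal.ofNat_ne_top) k)).exists
  choose ns hns using hex
  refine ⟨ns, ae_eventually_notMem (ne_top_of_le_ne_top ?_ (ENNReal.tsum_le_tsum hns))⟩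
  rw [ENNReal.tsum_geometric, ENNReal.one_sub_inv_two, inv_inv]
  exact ENNReal.ofNat_ne_top

lemma exists_seq_ae_tendsto_of_eq_off (hs : Tendsto (fun n => μ (s n)) atTop (𝓝 0))
    (hfg : ∀ n, ∀ ω ∉ s n, g n ω = f ω) :
    ∃ ns : ℕ → ℕ, ∀ᵐ ω ∂μ, Tendsto (fun k => g (ns k) ω) atTop (𝓝 (f ω)) := by
  obtain ⟨ns, hns⟩ := exists_seq_ae_eventually_notMem hs
  refine ⟨ns, hns.mono fun ω hω => tendsto_const_nhds.congr' ?_⟩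
  exact hω.mono fun k hk => (hfg _ ω hk).symm

lemma aemeasurable_of_eq_off (hs : Tendsto (fun n => μ (s n)) atTop (𝓝 0))
    (hg : ∀ n, Measurable (g n)) (hfg : ∀ n, ∀ ω ∉ s n, g n ω = f ω) : AEMeasurable f μ := by
  obtain ⟨ns, hlim⟩ := exists_seq_ae_tendsto_of_eq_off hs hfg
  exact aemeasurable_of_tendsto_metrizable_ae' (fun k => (hg (ns k)).aemeasurable) hlim

lemma lintegral_le_of_eq_off (hs : Tendsto (fun n => μ (s n)) atTop (𝓝 0))
    (hg : ∀ n, Measurable (g n)) (hfg : ∀ n, ∀ ω ∉ s n, g n ω = f ω) {b : ℝ≥0∞}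
    (hb : ∀ n, ∫⁻ ω, g n ω ∂μ ≤ b) : ∫⁻ ω, f ω ∂μ ≤ b := by
  obtain ⟨ns, hlim⟩ := exists_seq_ae_tendsto_of_eq_off hs hfg
  calc ∫⁻ ω, f ω ∂μ = ∫⁻ ω, liminf (fun k => g (ns k) ω) atTop ∂μ :=
        lintegral_congr_ae (hlim.mono fun ω hω => hω.liminf_eq.symm)
    _ ≤ liminf (fun k => ∫⁻ ω, g (ns k) ω ∂μ) atTop := lintegral_liminf_le fun k => hg (ns k)
    _ ≤ liminf (fun _ => b) atTop := liminf_le_liminf (.of_forall fun k => hb (ns k))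
    _ = b := liminf_const b

end VanishingEvents

section Skeleton

variable {M S Ω : Type*} (Γ : M → S → S) (R : M → S → ℝ) (X : M → Ω → Set (ℝ × ℝ)) (z : S) (T : ℝ)

/-- The state of the discretized dynamics after `j` of the `n + 1` slices of `(0, T]`. -/
noncomputable def skeleton (n j : ℕ) (ω : Ω) : S :=
  applyMarks Γ z (history Γ R X (mesh T n) z ω j)

/-- The event that one of the `n + 1` slices of `(0, T]` is bad for the state in which the
discretized dynamics enters it. -/
def badEvent (n : ℕ) : Set Ω :=
  {ω | ∃ i < n + 1, IsBadSlice Γ R X (mesh T n) i (skeleton Γ R X z T n i ω) ω}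

variable {Γ R X z T} {n : ℕ} {ω : Ω}

lemma evolves_skeleton (hT : 0 ≤ T) (hω : ω ∉ badEvent Γ R X z T n) {j : ℕ} (hj : j ≤ n + 1) :
    Evolves Γ R (fun m => X m ω) 0 z (j * mesh T n) (skeleton Γ R X z T n j ω) :=
  evolves_history (mesh_nonneg hT n) z j fun i hi hb => hω ⟨i, hi.trans_le hj, hb⟩

lemma exists_evolves_skeleton (hT : 0 ≤ T) (hω : ω ∉ badEvent Γ R X z T n) {t : ℝ}
    (ht : t ∈ Set.Icc 0 T) :
    ∃ j ≤ n + 1, Evolves Γ R (fun m => X m ω) 0 z t (skeleton Γ R X z T n j ω) :=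
  exists_evolves_history (mesh_nonneg hT n) z (n + 1) (fun i hi hb => hω ⟨i, hi, hb⟩)
    (by rwa [succ_mul_mesh])

variable {Φ : ℝ → Ω → S}
  (hΦ : ∀ ω t w, Evolves Γ R (fun m => X m ω) 0 z t w → Φ t ω = w)

include hΦ

lemma skeleton_last_eq (hT : 0 ≤ T) (hω : ω ∉ badEvent Γ R X z T n) :
    skeleton Γ R X z T n (n + 1) ω = Φ T ω := by
  have hev := evolves_skeleton hT hω le_rfl
  rw [succ_mul_mesh] at hev
  exact (hΦ _ _ _ hev).symm

lemma iSup_skeleton_eq (hT : 0 ≤ T) (hω : ω ∉ badEvent Γ R X z T n) (f : S → ℝ≥0∞) :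
    ⨆ j ∈ Set.Iic (n + 1), f (skeleton Γ R X z T n j ω) = ⨆ t ∈ Set.Icc 0 T, f (Φ t ω) := by
  refine le_antisymm (iSup₂_le fun j hj => ?_) (iSup₂_le fun t ht => ?_)
  · have hjT : (j : ℝ) * mesh T n ≤ T :=
      (mul_le_mul_of_nonneg_right (Nat.cast_le.2 hj) (mesh_nonneg hT n)).trans_eq
        (succ_mul_mesh T n)
    rw [← hΦ _ _ _ (evolves_skeleton hT hω hj)]
    exact le_iSup₂_of_le (j * mesh T n) ⟨mul_nonneg j.cast_nonneg (mesh_nonneg hT n), hjT⟩ le_rfl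
  · obtain ⟨j, hj, hev⟩ := exists_evolves_skeleton hT hω ht
    rw [hΦ _ _ _ hev]
    exact le_iSup₂ (f := fun j (_ : j ∈ Set.Iic (n + 1)) => f (skeleton Γ R X z T n j ω)) j hj

end Skeleton

/-- `N` is a Lyapunov function on `I` that excludes explosion: it grows at most exponentially in
expectation, and the rates are controlled where it is bounded. -/
structure IsLyapunov {M S : Type*} (Γ : M → S → S) (R : M → S → ℝ) (I : Set S) (N : S → ℝ≥0∞) :
    Prop where
  mapsTo : ∀ m, Set.MapsTo (Γ m) I I
  exists_hasDriftBound : ∃ c : ℝ≥0, HasDriftBound Γ R I c N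
  ne_top : ∀ z ∈ I, N z ≠ ∞
  exists_pairRate_le : ∀ K : ℕ, ∃ D ≠ ∞, ∀ z, N z ≤ K → pairRate Γ R z ≤ D

namespace IsPoissonNoise

variable {M S Ω : Type*} {Γ : M → S → S} {R : M → S → ℝ} {X : M → Ω → Set (ℝ × ℝ)}
  {I : Set S} {z : S} {N : S → ℝ≥0∞} {T : ℝ} [Countable M] [MeasurableSpace Ω] {μ : Measure Ω}
  (hX : IsPoissonNoise X μ)

include hX

lemma measurable_skeleton (f : S → ℝ≥0∞) (n j : ℕ) :
    Measurable fun ω => f (skeleton Γ R X z T n j ω) :=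
  measurable_comp_of_countable (hX.measurableSet_history Γ z j) fun l => f (applyMarks Γ z l)

variable [IsProbabilityMeasure μ]

lemma measure_exists_lt_skeleton_le {f : S → ℝ≥0∞} {c : ℝ≥0} (hf : HasDriftBound Γ R I c f)
    (hI : ∀ m, Set.MapsTo (Γ m) I I) (hz : z ∈ I) (hT : 0 ≤ T) {A : ℝ≥0∞} (hA : A ≠ 0)
    (hA' : A ≠ ∞) (n : ℕ) :
    μ {ω | ∃ j ≤ n + 1, A < f (skeleton Γ R X z T n j ω)}
      ≤ ENNReal.ofReal (Real.exp (c * T)) * f z / A := by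
  refine (hX.measure_exists_lt_history_le (mesh_nonneg hT n) hf hI hz hA hA' (n + 1)).trans ?_
  gcongr
  exact one_add_mesh_mul_pow_le_exp hT c n

variable (hN : IsLyapunov Γ R I N) (hz : z ∈ I) (hT : 0 ≤ T)

include hN hz hT

lemma tendsto_measure_badEvent :
    Tendsto (fun n => μ (badEvent Γ R X z T n)) atTop (𝓝 0) := by
  obtain ⟨c, hc⟩ := hN.exists_hasDriftBound
  have hlarge := tendsto_div_natCast_succ
    (ENNReal.mul_ne_top ENNReal.ofReal_ne_top (hN.ne_top z hz) :
      ENNReal.ofReal (Real.exp (c * T)) * N z ≠ ∞)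
  rw [ENNReal.tendsto_nhds_zero]
  intro ε hε
  have hε2 : 0 < ε / 2 := ENNReal.half_pos hε.ne'
  obtain ⟨K, hK⟩ := (ENNReal.tendsto_nhds_zero.1 hlarge _ hε2).exists
  obtain ⟨D, hDtop, hD⟩ := hN.exists_pairRate_le (K + 1)
  filter_upwards [ENNReal.tendsto_nhds_zero.1 (tendsto_succ_mul_mesh_sq hT hDtop) _ hε2] with n hn
  have hlt := hX.measure_exists_lt_skeleton_le hc hN.mapsTo hz hT (A := (K + 1 : ℕ)) (by simp)
    (ENNReal.natCast_ne_top _) n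
  calc μ (badEvent Γ R X z T n)
      ≤ μ {ω | ∃ j ≤ n + 1, skeleton Γ R X z T n j ω ∉ {y | N y ≤ (K + 1 : ℕ)}} +
          (n + 1 : ℕ) * (ENNReal.ofReal (mesh T n) ^ 2 * D) :=
        hX.measure_exists_isBadSlice_history_le (mesh_nonneg hT n) z (n + 1) hD
    _ ≤ ε / 2 + ε / 2 := by
        simp only [Set.mem_ofPred_eq, not_le]
        exact add_le_add (hlt.trans hK) hn
    _ = ε := ENNReal.add_halves ε

omit hT in
lemma ae_exists_evolves : ∀ᵐ ω ∂μ, ∀ t, 0 ≤ t → ∃ w, Evolves Γ R (fun m => X m ω) 0 z t w := by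
  have hbdd (K : ℕ) : ∀ᵐ ω ∂μ, ∀ t ∈ Set.Icc 0 (K : ℝ),
      ∃ w, Evolves Γ R (fun m => X m ω) 0 z t w := by
    obtain ⟨ns, hns⟩ := exists_seq_ae_eventually_notMem
      (hX.tendsto_measure_badEvent hN hz K.cast_nonneg)
    filter_upwards [hns] with ω hω t ht
    obtain ⟨k, hk⟩ := hω.exists
    obtain ⟨j, -, hev⟩ := exists_evolves_skeleton K.cast_nonneg hk ht
    exact ⟨_, hev⟩
  filter_upwards [ae_all_iff.2 hbdd] with ω hω t ht
  obtain ⟨K, hK⟩ := exists_nat_ge t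
  exact hω K t ⟨ht, hK⟩

variable {Φ : ℝ → Ω → S} (hΦ : ∀ ω t w, Evolves Γ R (fun m => X m ω) 0 z t w → Φ t ω = w)

include hΦ

lemma aemeasurable_iSup (f : S → ℝ≥0∞) :
    AEMeasurable (fun ω => ⨆ t ∈ Set.Icc 0 T, f (Φ t ω)) μ :=
  aemeasurable_of_eq_off (hX.tendsto_measure_badEvent hN hz hT)
    (fun n => .biSup _ (Set.to_countable _) fun j _ => hX.measurable_skeleton f n j)
    fun _ _ hω => iSup_skeleton_eq hΦ hT hω f

lemma aemeasurable_apply (f : S → ℝ≥0∞) : AEMeasurable (fun ω => f (Φ T ω)) μ :=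
  aemeasurable_of_eq_off (hX.tendsto_measure_badEvent hN hz hT)
    (fun n => hX.measurable_skeleton f n (n + 1))
    fun _ _ hω => congrArg f (skeleton_last_eq hΦ hT hω)

variable {f : S → ℝ≥0∞} {c : ℝ≥0} (hf : HasDriftBound Γ R I c f)

include hf

lemma lintegral_apply_le :
    ∫⁻ ω, f (Φ T ω) ∂μ ≤ ENNReal.ofReal (Real.exp (c * T)) * f z := by
  refine lintegral_le_of_eq_off (hX.tendsto_measure_badEvent hN hz hT)
    (fun n => hX.measurable_skeleton f n (n + 1))
    (fun _ _ hω => congrArg f (skeleton_last_eq hΦ hT hω)) fun n => ?_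
  refine (hX.lintegral_applyMarks_history_le (mesh_nonneg hT n) hf hN.mapsTo hz (n + 1)).trans ?_
  gcongr
  exact one_add_mesh_mul_pow_le_exp hT c n

lemma measure_lt_iSup_le {A : ℝ≥0∞} (hA : A ≠ 0) (hA' : A ≠ ∞) :
    μ {ω | A < ⨆ t ∈ Set.Icc 0 T, f (Φ t ω)}
      ≤ ENNReal.ofReal (Real.exp (c * T)) * f z / A := by
  have hlim := (hX.tendsto_measure_badEvent hN hz hT).add_const
    (ENNReal.ofReal (Real.exp (c * T)) * f z / A)
  rw [zero_add] at hlim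
  refine ge_of_tendsto' hlim fun n => ?_
  have hsub : {ω | A < ⨆ t ∈ Set.Icc 0 T, f (Φ t ω)} ⊆
      badEvent Γ R X z T n ∪ {ω | ∃ j ≤ n + 1, A < f (skeleton Γ R X z T n j ω)} := by
    intro ω hω
    by_cases hbad : ω ∈ badEvent Γ R X z T n
    · exact .inl hbad
    · rw [Set.mem_ofPred_eq, ← iSup_skeleton_eq hΦ hT hbad] at hω
      simp only [lt_iSup_iff] at hω
      obtain ⟨j, hj, hlt⟩ := hω
      exact .inr ⟨j, hj, hlt⟩
  refine (measure_mono hsub).trans ((measure_union_le _ _).trans ?_)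
  gcongr
  exact hX.measure_exists_lt_skeleton_le hf hN.mapsTo hz hT hA hA' n

end IsPoissonNoise

/-! ### Marks and weights -/

section Marks

variable {V : Type*}

/-- The marks as a sum type; this makes them countable and sums over them computable. -/
def markEquiv (V : Type*) : (V ⊕ V) ⊕ (V × V) ≃ Mark V where
  toFun
    | .inl (.inl x) => .birth x
    | .inl (.inr x) => .death x
    | .inr (x, y) => .jump x y
  invFun
    | .birth x => .inl (.inl x)
    | .death x => .inl (.inr x)
    | .jump x y => .inr (x, y)
  left_inv := by rintro ((x | x) | ⟨x, y⟩) <;> rfl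
  right_inv := by rintro (x | x | ⟨x, y⟩) <;> rfl

instance [Countable V] : Countable (Mark V) := (markEquiv V).symm.injective.countable

lemma tsum_mark (f : Mark V → ℝ≥0∞) :
    ∑' m, f m = ∑' x, f (.birth x) + ∑' x, f (.death x) + ∑' x, ∑' y, f (.jump x y) := by
  rw [← (markEquiv V).tsum_eq, Summable.tsum_sum ENNReal.summable ENNReal.summable,
    Summable.tsum_sum ENNReal.summable ENNReal.summable, ENNReal.tsum_prod']
  rfl

lemma single_apply_self (x : V) : single x x = 1 := if_pos rfl

lemma single_apply_of_ne {x y : V} (h : y ≠ x) : single x y = 0 := if_neg h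

lemma add_single_le {z w : V → ℕ} (hle : z ≤ w) {x : V} (hlt : z x < w x) : z + single x ≤ w := by
  intro y
  rcases eq_or_ne y x with rfl | hy
  · rwa [Pi.add_apply, single_apply_self]
  · simpa only [Pi.add_apply, single_apply_of_ne hy, add_zero] using hle y

lemma single_le {z : V → ℕ} {x : V} (hx : z x ≠ 0) : single x ≤ z := by
  simpa only [zero_add] using add_single_le (zero_le : 0 ≤ z) (Nat.pos_of_ne_zero hx)

/-- The particle that a transition removes, as a configuration. -/
noncomputable def removed : Mark V → V → ℕ
  | .birth _ => 0
  | .death x => single x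
  | .jump x _ => single x

/-- The particle that a transition adds, as a configuration. -/
noncomputable def added : Mark V → V → ℕ
  | .birth x => single x
  | .death _ => 0
  | .jump _ y => single y

lemma transition_eq (m : Mark V) (z : V → ℕ) : transition m z = z - removed m + added m := by
  cases m <;> simp [transition, removed, added]

lemma monotone_transition (m : Mark V) : Monotone (transition m) := by
  intro z w hle
  rw [transition_eq, transition_eq]
  exact add_le_add_left (tsub_le_tsub_right hle _) _

lemma transition_le_add_added (m : Mark V) (z : V → ℕ) : transition m z ≤ z + added m := by
  rw [transition_eq]
  exact add_le_add_left tsub_le_self _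

end Marks

section Weight

variable {V : Type*} (w : V → ℝ≥0∞)

/-- The total weight of a configuration when a particle at `x` has weight `w x`. -/
noncomputable def weight (z : V → ℕ) : ℝ≥0∞ := ∑' x, w x * z x

/-- The number of particles of a configuration. -/
noncomputable abbrev mass (z : V → ℕ) : ℝ≥0∞ := weight (fun _ => 1) z

lemma weight_mono : Monotone (weight w) := fun z z' h => ENNReal.tsum_le_tsum fun x => by
  gcongr
  exact h x

lemma weight_add (z z' : V → ℕ) : weight w (z + z') = weight w z + weight w z' := by
  simp only [weight, ← ENNReal.tsum_add, Pi.add_apply, Nat.cast_add, mul_add]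

lemma weight_zero : weight w 0 = 0 := by simp [weight]

lemma weight_single (x : V) : weight w (single x) = w x := by
  rw [weight, tsum_eq_single x fun y hy => by simp [single_apply_of_ne hy]]
  simp [single_apply_self]

lemma natCast_le_mass (z : V → ℕ) (x : V) : (z x : ℝ≥0∞) ≤ mass z := by
  simpa only [mass, weight, one_mul] using ENNReal.le_tsum (f := fun x => (z x : ℝ≥0∞)) x

lemma mass_added_le (m : Mark V) : mass (added m) ≤ 1 := by
  cases m <;> simp [added, weight_zero, weight_single]

lemma mass_transition_le (m : Mark V) (z : V → ℕ) : mass (transition m z) ≤ mass z + 1 := by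
  refine (weight_mono _ (transition_le_add_added m z)).trans ?_
  rw [weight_add]
  gcongr
  exact mass_added_le m

lemma mem_finiteConf_iff_mass_ne_top {z : V → ℕ} : z ∈ finiteConf V ↔ mass z ≠ ∞ := by
  have hmass : mass z = ∑' x, ((z x : ℝ≥0) : ℝ≥0∞) := by simp [weight]
  rw [hmass, ENNReal.tsum_coe_ne_top_iff_summable, ← NNReal.summable_coe]
  rfl

lemma finite_support_of_mem_finiteConf {z : V → ℕ} (hz : z ∈ finiteConf V) :
    (Function.support z).Finite := by
  have hlt : ∀ᶠ x in cofinite, toRealConf z x < 1 :=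
    Summable.tendsto_cofinite_zero hz |>.eventually (gt_mem_nhds one_pos)
  refine (eventually_cofinite.1 hlt).subset fun x hx => ?_
  simpa [toRealConf, Nat.one_le_iff_ne_zero] using hx

lemma mapsTo_transition_finiteConf (m : Mark V) :
    Set.MapsTo (transition m) (finiteConf V) (finiteConf V) := by
  intro z hz
  rw [mem_finiteConf_iff_mass_ne_top] at hz ⊢
  exact ne_top_of_le_ne_top (by finiteness) (mass_transition_le m z)

lemma tsum_ne_top_of_mem_finiteConf {z : V → ℕ} (hz : z ∈ finiteConf V) {f : V → ℝ≥0∞}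
    (hf : ∀ x, f x ≠ ∞) (hf₀ : ∀ x, z x = 0 → f x = 0) : ∑' x, f x ≠ ∞ := by
  have hfin := finite_support_of_mem_finiteConf hz
  rw [tsum_eq_sum (s := hfin.toFinset) fun x hx => hf₀ x (by simpa using hx)]
  exact ENNReal.sum_ne_top.2 fun x _ => hf x

end Weight

/-! ### Subcritical rates -/

/-- Deaths dominate births and the total jump rates of a particle are at most `L`. A negative
birth rate has the effect of the rate `0`. -/
structure IsSubcritical {V : Type*} (p : V → V → ℝ) (Fp Fm : ℕ → ℝ) (L : ℝ≥0) : Prop where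
  jump_nonneg : ∀ x y, 0 ≤ p x y
  tsum_jump_le : ∀ x, ∑' y, ENNReal.ofReal (p x y) ≤ L
  death_zero : Fm 0 = 0
  birth_le_death : ∀ n, Fp n ≤ Fm n

namespace IsSubcritical

variable {V : Type*} {p : V → V → ℝ} {Fp Fm : ℕ → ℝ} {L : ℝ≥0} (h : IsSubcritical p Fp Fm L)

include h

lemma isAttractive : IsAttractive transition (rate p Fp Fm) where
  monotone := monotone_transition
  transition_le := by
    rintro (x | x | ⟨x, y⟩) z w hle hlt
    · exact add_single_le hle ((hle x).lt_of_ne fun he => hlt.ne (congrArg Fp he.symm))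
    · exact tsub_le_self.trans hle
    · refine absurd hlt (not_lt.2 (mul_le_mul_of_nonneg_left ?_ (h.jump_nonneg x y)))
      exact Nat.cast_le.2 (hle x)
  le_transition := by
    rintro (x | x | ⟨x, y⟩) z w hle hlt
    · exact hle.trans le_self_add
    · have hx : z x < w x := (hle x).lt_of_ne fun he => hlt.ne (congrArg Fm he)
      exact le_tsub_of_add_le_right (add_single_le hle hx)
    · have hx : z x < w x := Nat.cast_lt.1 (lt_of_mul_lt_mul_left hlt (h.jump_nonneg x y))
      exact (le_tsub_of_add_le_right (add_single_le hle hx)).trans le_self_add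

end IsSubcritical

section Drift

variable {V : Type*} {p : V → V → ℝ} {Fp Fm : ℕ → ℝ} {L : ℝ≥0} {z : V → ℕ}

lemma ofReal_rate_jump (x y : V) (z : V → ℕ) :
    ENNReal.ofReal (rate p Fp Fm (.jump x y) z) = ENNReal.ofReal (p x y) * z x := by
  rw [rate, ENNReal.ofReal_mul' (Nat.cast_nonneg _), ENNReal.ofReal_natCast]

lemma removed_le_of_rate_ne_zero (hF : Fm 0 = 0) {m : Mark V} (hm : rate p Fp Fm m z ≠ 0) :
    removed m ≤ z := by
  rcases m with x | x | ⟨x, y⟩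
  · exact zero_le
  · exact single_le fun hx => hm (by simp [rate, hx, hF])
  · exact single_le fun hx => hm (by simp [rate, hx])

lemma rate_mul_weight_transition_add (hF : Fm 0 = 0) (w : V → ℝ≥0∞) (m : Mark V) (z : V → ℕ) :
    ENNReal.ofReal (rate p Fp Fm m z) * weight w (transition m z) +
        ENNReal.ofReal (rate p Fp Fm m z) * weight w (removed m)
      = ENNReal.ofReal (rate p Fp Fm m z) * weight w z +
        ENNReal.ofReal (rate p Fp Fm m z) * weight w (added m) := by
  by_cases hm : rate p Fp Fm m z = 0
  · simp [hm]
  · have hle := removed_le_of_rate_ne_zero hF hm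
    rw [← mul_add, ← mul_add, ← weight_add, ← weight_add, transition_eq, add_right_comm,
      tsub_add_cancel_of_le hle]

lemma tsum_rate_mul_weight_removed (w : V → ℝ≥0∞) (z : V → ℕ) :
    ∑' m, ENNReal.ofReal (rate p Fp Fm m z) * weight w (removed m)
      = ∑' x, ENNReal.ofReal (Fm (z x)) * w x +
        ∑' x, (∑' y, ENNReal.ofReal (p x y)) * (z x * w x) := by
  simp only [tsum_mark, removed, weight_zero, weight_single, mul_zero, tsum_zero, zero_add,
    ofReal_rate_jump, mul_assoc, ENNReal.tsum_mul_right]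
  rfl

lemma tsum_rate_mul_weight_added (w : V → ℝ≥0∞) (z : V → ℕ) :
    ∑' m, ENNReal.ofReal (rate p Fp Fm m z) * weight w (added m)
      = ∑' x, ENNReal.ofReal (Fp (z x)) * w x +
        ∑' x, (∑' y, ENNReal.ofReal (p x y) * w y) * z x := by
  simp only [tsum_mark, added, weight_zero, weight_single, mul_zero, tsum_zero, add_zero,
    ofReal_rate_jump, mul_right_comm _ (z _ : ℝ≥0∞), ENNReal.tsum_mul_right]
  rfl

end Drift

namespace IsSubcritical

variable {V : Type*} {p : V → V → ℝ} {Fp Fm : ℕ → ℝ} {L : ℝ≥0} (h : IsSubcritical p Fp Fm L)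
  {z : V → ℕ}

include h

lemma tsum_rate_mul_weight_removed_ne_top {w : V → ℝ≥0∞} (hw : ∀ x, w x ≠ ∞)
    (hz : z ∈ finiteConf V) :
    ∑' m, ENNReal.ofReal (rate p Fp Fm m z) * weight w (removed m) ≠ ∞ := by
  rw [tsum_rate_mul_weight_removed]
  refine ENNReal.add_ne_top.2 ⟨?_, ?_⟩ <;>
    refine tsum_ne_top_of_mem_finiteConf hz (fun x => ?_) fun x hx => ?_
  · exact ENNReal.mul_ne_top ENNReal.ofReal_ne_top (hw x)
  · simp [hx, h.death_zero]
  · exact ENNReal.mul_ne_top (ne_top_of_le_ne_top ENNReal.coe_ne_top (h.tsum_jump_le x))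
      (ENNReal.mul_ne_top (ENNReal.natCast_ne_top _) (hw x))
  · simp [hx]

lemma hasDriftBound_weight {w : V → ℝ≥0∞} (hw : ∀ x, w x ≠ ∞) {c : ℝ≥0∞}
    (hpw : ∀ x, ∑' y, ENNReal.ofReal (p x y) * w y ≤ c * w x) :
    HasDriftBound transition (rate p Fp Fm) (finiteConf V) c (weight w) := by
  intro z hz
  have hadded : ∑' m, ENNReal.ofReal (rate p Fp Fm m z) * weight w (added m)
      ≤ ∑' m, ENNReal.ofReal (rate p Fp Fm m z) * weight w (removed m) + c * weight w z := by
    rw [tsum_rate_mul_weight_added, tsum_rate_mul_weight_removed, weight, ← ENNReal.tsum_mul_left]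
    refine add_le_add (ENNReal.tsum_le_tsum fun x => ?_) (ENNReal.tsum_le_tsum fun x => ?_) |>.trans
      (add_le_add_left le_self_add _)
    · gcongr
      exact h.birth_le_death _
    · rw [← mul_assoc]
      gcongr
      exact hpw x
  have hbalance := tsum_congr (L := .unconditional _) fun m =>
    rate_mul_weight_transition_add (p := p) (Fp := Fp) h.death_zero w m z
  rw [ENNReal.tsum_add, ENNReal.tsum_add, ENNReal.tsum_mul_right] at hbalance
  refine (ENNReal.add_le_add_iff_right (h.tsum_rate_mul_weight_removed_ne_top hw hz)).1 ?_
  rw [hbalance, add_mul, add_right_comm, add_assoc]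
  exact add_le_add le_rfl hadded

end IsSubcritical

section RateBound

variable {V : Type*}

/-- A bound for the rates in configurations in which the death rates are at most `G`. -/
noncomputable def rateBound (p : V → V → ℝ) (G : ℝ≥0∞) : Mark V → (V → ℕ) → ℝ≥0∞
  | .birth x, z => G * z x
  | .death x, z => G * z x
  | .jump x y, z => ENNReal.ofReal (p x y) * z x

lemma ofReal_le_mul_natCast {F : ℕ → ℝ} (hF : F 0 = 0) {G : ℝ≥0∞} {n k : ℕ}
    (hG : ENNReal.ofReal (F n) ≤ G) (hk : k = 0 → n = 0) : ENNReal.ofReal (F n) ≤ G * k := by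
  rcases eq_or_ne k 0 with rfl | hk0
  · simp [hk rfl, hF]
  · exact hG.trans (le_mul_of_one_le_right zero_le (by exact_mod_cast Nat.one_le_iff_ne_zero.2 hk0))

lemma tsum_sq_le_sq_tsum {ι : Type*} (f : ι → ℝ≥0∞) : ∑' i, f i ^ 2 ≤ (∑' i, f i) ^ 2 := by
  simp only [sq, ← ENNReal.tsum_mul_right]
  gcongr with i
  exact ENNReal.le_tsum i

end RateBound

namespace IsSubcritical

variable {V : Type*} {p : V → V → ℝ} {Fp Fm : ℕ → ℝ} {L : ℝ≥0} (h : IsSubcritical p Fp Fm L)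
  {G : ℝ≥0∞} {z : V → ℕ} {K : ℕ}

include h

lemma tsum_rateBound_le (G : ℝ≥0∞) (z : V → ℕ) :
    ∑' m, rateBound p G m z ≤ (G + G + L) * mass z := by
  simp only [tsum_mark, rateBound, ENNReal.tsum_mul_left, ENNReal.tsum_mul_right, mass, weight,
    one_mul, add_mul]
  rw [← ENNReal.tsum_mul_left (a := (L : ℝ≥0∞))]
  gcongr with x
  exact h.tsum_jump_le x

lemma ofReal_rate_le (hG : ∀ n ≤ K, ENNReal.ofReal (Fm n) ≤ G) (hz : ∀ x, z x ≤ K) (m : Mark V) :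
    ENNReal.ofReal (rate p Fp Fm m z) ≤ rateBound p G m z := by
  have hdeath (x : V) : ENNReal.ofReal (Fm (z x)) ≤ G * z x :=
    ofReal_le_mul_natCast h.death_zero (hG _ (hz x)) id
  rcases m with x | x | ⟨x, y⟩
  · exact (ENNReal.ofReal_le_ofReal (h.birth_le_death _)).trans (hdeath x)
  · exact hdeath x
  · exact (ofReal_rate_jump x y z).le

lemma ne_zero_of_rate_birth_pos {x : V} (hx : 0 < rate p Fp Fm (.birth x) z) : z x ≠ 0 :=
  fun h0 => hx.not_ge (by simpa [rate, h0, h.death_zero] using h.birth_le_death 0)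

lemma ofReal_rate_transition_le (hG : ∀ n ≤ K + 1, ENNReal.ofReal (Fm n) ≤ G)
    (hz : ∀ x, z x ≤ K) {m : Mark V} (hm : 0 < rate p Fp Fm m z) :
    ENNReal.ofReal (rate p Fp Fm m (transition m z)) ≤ rateBound p G m z := by
  have hdeath {n : ℕ} {x : V} (hx : z x ≠ 0) (hn : n ≤ z x + 1) :
      ENNReal.ofReal (Fm n) ≤ G * z x :=
    ofReal_le_mul_natCast h.death_zero (hG _ (hn.trans (Nat.succ_le_succ (hz x))))
      fun h0 => absurd h0 hx
  rcases m with x | x | ⟨x, y⟩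
  · refine (ENNReal.ofReal_le_ofReal (h.birth_le_death _)).trans
      (hdeath (h.ne_zero_of_rate_birth_pos hm) ?_)
    simp [transition, single_apply_self]
  · refine hdeath (fun h0 => hm.ne' (by simp [rate, h0, h.death_zero])) ?_
    simp only [transition, Pi.sub_apply, single_apply_self]
    omega
  · have h0 : z x ≠ 0 := fun h0 => hm.ne' (by simp [rate, h0])
    rw [ofReal_rate_jump, rateBound]
    gcongr
    rcases eq_or_ne x y with rfl | hxy
    · simp only [transition, Pi.add_apply, Pi.sub_apply, single_apply_self]
      omega
    · simp [transition, single_apply_of_ne hxy]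

lemma totalRate_le (hG : ∀ n ≤ K, ENNReal.ofReal (Fm n) ≤ G) (hz : mass z ≤ K) :
    totalRate (rate p Fp Fm) z ≤ (G + G + L) * K := by
  have hzK (x : V) : z x ≤ K := by exact_mod_cast (natCast_le_mass z x).trans hz
  calc totalRate (rate p Fp Fm) z ≤ ∑' m, rateBound p G m z :=
        ENNReal.tsum_le_tsum (h.ofReal_rate_le hG hzK)
    _ ≤ (G + G + L) * mass z := h.tsum_rateBound_le G z
    _ ≤ (G + G + L) * K := by gcongr

lemma tsum_max_rate_transition_le (hG : ∀ n ≤ K + 1, ENNReal.ofReal (Fm n) ≤ G) (hz : mass z ≤ K)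
    (m : Mark V) :
    ∑' m', ENNReal.ofReal (max (rate p Fp Fm m' z) (rate p Fp Fm m' (transition m z)))
      ≤ (G + G + L) * K + (G + G + L) * (K + 1 : ℕ) := by
  have hmass : mass (transition m z) ≤ (K + 1 : ℕ) := by
    rw [Nat.cast_succ]
    exact (mass_transition_le m z).trans (by gcongr)
  calc _ ≤ totalRate (rate p Fp Fm) z + totalRate (rate p Fp Fm) (transition m z) := by
        rw [totalRate, totalRate, ← ENNReal.tsum_add]
        gcongr with m'
        rw [ENNReal.ofReal_max]
        exact max_le_add_of_nonneg zero_le zero_le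
    _ ≤ _ := add_le_add (h.totalRate_le (fun n hn => hG n (Nat.le_succ_of_le hn)) hz)
        (h.totalRate_le hG hmass)

lemma tsum_sq_max_rate_le (hG : ∀ n ≤ K + 1, ENNReal.ofReal (Fm n) ≤ G) (hz : mass z ≤ K) :
    ∑' m, (if 0 < rate p Fp Fm m z then
        ENNReal.ofReal (max (rate p Fp Fm m z) (rate p Fp Fm m (transition m z))) else 0) ^ 2
      ≤ ((G + G + L) * K) ^ 2 := by
  have hzK (x : V) : z x ≤ K := by exact_mod_cast (natCast_le_mass z x).trans hz
  refine (tsum_sq_le_sq_tsum _).trans ?_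
  gcongr
  calc _ ≤ ∑' m, rateBound p G m z := by
        gcongr with m
        split_ifs with hm
        · rw [ENNReal.ofReal_max]
          exact max_le (h.ofReal_rate_le (fun n hn => hG n (Nat.le_succ_of_le hn)) hzK m)
            (h.ofReal_rate_transition_le hG hzK hm)
        · exact zero_le
    _ ≤ (G + G + L) * mass z := h.tsum_rateBound_le G z
    _ ≤ (G + G + L) * K := by gcongr

lemma exists_pairRate_le (K : ℕ) :
    ∃ D ≠ ∞, ∀ z : V → ℕ, mass z ≤ K → pairRate transition (rate p Fp Fm) z ≤ D := by
  set G : ℝ≥0∞ := ∑ n ∈ Finset.range (K + 2), ENNReal.ofReal (Fm n)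
  have hGtop : G ≠ ∞ := ENNReal.sum_ne_top.2 fun _ _ => ENNReal.ofReal_ne_top
  have hG (n : ℕ) (hn : n ≤ K + 1) : ENNReal.ofReal (Fm n) ≤ G :=
    Finset.single_le_sum (f := fun n => ENNReal.ofReal (Fm n)) (fun _ _ => zero_le)
      (Finset.mem_range.2 (Nat.lt_succ_of_le hn))
  set B := (G + G + L) * K
  refine ⟨B * (B + (G + G + L) * (K + 1 : ℕ)) + B ^ 2, by finiteness, fun z hz => ?_⟩
  rw [pairRate, ENNReal.tsum_add]
  refine add_le_add ?_ (h.tsum_sq_max_rate_le hG hz)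
  calc _ ≤ ∑' m, ENNReal.ofReal (rate p Fp Fm m z) * (B + (G + G + L) * (K + 1 : ℕ)) := by
        gcongr with m
        exact h.tsum_max_rate_transition_le hG hz m
    _ = totalRate (rate p Fp Fm) z * (B + (G + G + L) * (K + 1 : ℕ)) := ENNReal.tsum_mul_right
    _ ≤ _ := by
        gcongr
        exact h.totalRate_le (fun n hn => hG n (Nat.le_succ_of_le hn)) hz

lemma isLyapunov_mass : IsLyapunov transition (rate p Fp Fm) (finiteConf V) mass where
  mapsTo := mapsTo_transition_finiteConf
  exists_hasDriftBound := ⟨L, h.hasDriftBound_weight (fun _ => ENNReal.one_ne_top) fun x => by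
    simpa only [mul_one] using h.tsum_jump_le x⟩
  ne_top _ hz := mem_finiteConf_iff_mass_ne_top.1 hz
  exists_pairRate_le := h.exists_pairRate_le

end IsSubcritical

/-! ### Convergence of configurations -/

section Convergence

variable {V : Type*}

/-- The localization function `α` as a weight with values in `ℝ≥0∞`. -/
noncomputable def alphaWeight (α : V → ℝ) (x : V) : ℝ≥0∞ := ENNReal.ofReal (α x)

lemma alphaWeight_ne_top (α : V → ℝ) (x : V) : alphaWeight α x ≠ ∞ := ENNReal.ofReal_ne_top

section Localization

variable {α : V → ℝ} (hα : ∀ x, 0 < α x)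

include hα

lemma alphaWeight_ne_zero (x : V) : alphaWeight α x ≠ 0 := (ENNReal.ofReal_pos.2 (hα x)).ne'

lemma alphaNorm_toRealConf (z : V → ℕ) : alphaNorm α (toRealConf z) = weight (alphaWeight α) z := by
  refine tsum_congr fun x => ?_
  rw [toRealConf, Nat.abs_cast, ENNReal.ofReal_mul (hα x).le, ENNReal.ofReal_natCast, alphaWeight]

lemma mem_alphaConf_iff {z : V → ℕ} : z ∈ alphaConf α ↔ weight (alphaWeight α) z ≠ ∞ := by
  rw [← alphaNorm_toRealConf hα, ← lt_top_iff_ne_top]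
  rfl

lemma eventually_eq_of_tendsto_alphaNorm_sub {ι : Type*} {l : Filter ι} {a : ι → V → ℕ}
    {b : V → ℕ}
    (h : Tendsto (fun i => alphaNorm α (toRealConf (a i) - toRealConf b)) l (𝓝 0)) (x : V) :
    ∀ᶠ i in l, a i x = b x := by
  filter_upwards [h.eventually (gt_mem_nhds (ENNReal.ofReal_pos.2 (hα x)))] with i hi
  by_contra hne
  have hone : (1 : ℝ) ≤ |(a i x : ℝ) - b x| := by
    exact_mod_cast Int.one_le_abs (sub_ne_zero.2 (Nat.cast_injective.ne hne : (a i x : ℤ) ≠ b x))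
  exact hi.not_ge ((ENNReal.ofReal_le_ofReal (le_mul_of_one_le_right (hα x).le hone)).trans
    (ENNReal.le_tsum x))

lemma ofReal_mul_abs_sub_le {a b : V → ℕ} (hab : a ≤ b) (x : V) :
    ENNReal.ofReal (α x * |(toRealConf a - toRealConf b) x|) ≤ alphaWeight α x * b x := by
  have hle : (a x : ℝ) ≤ b x := Nat.cast_le.2 (hab x)
  rw [alphaWeight, ← ENNReal.ofReal_natCast, ← ENNReal.ofReal_mul (hα x).le]
  refine ENNReal.ofReal_le_ofReal (mul_le_mul_of_nonneg_left ?_ (hα x).le)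
  rw [Pi.sub_apply, toRealConf, toRealConf, abs_of_nonpos (sub_nonpos.2 hle), neg_sub]
  exact sub_le_self _ (Nat.cast_nonneg _)

lemma tendsto_alphaNorm_sub {a : ℕ → V → ℕ} {b : V → ℕ} (hb : weight (alphaWeight α) b ≠ ∞)
    (hab : ∀ n, a n ≤ b) (hlim : ∀ x, ∀ᶠ n in atTop, a n x = b x) :
    Tendsto (fun n => alphaNorm α (toRealConf (a n) - toRealConf b)) atTop (𝓝 0) := by
  let _ : MeasurableSpace V := ⊤
  have hdominated := tendsto_lintegral_of_dominated_convergence (μ := Measure.count)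
    (F := fun n x => ENNReal.ofReal (α x * |(toRealConf (a n) - toRealConf b) x|))
    (f := fun _ => 0) (fun x => alphaWeight α x * b x) (fun n => measurable_from_top)
    (fun n => .of_forall (ofReal_mul_abs_sub_le hα (hab n)))
  simp only [lintegral_count' measurable_from_top, tsum_zero] at hdominated
  refine hdominated hb (.of_forall fun x => tendsto_const_nhds.congr' ?_)
  filter_upwards [hlim x] with n hn
  simp [toRealConf, hn]

end Localization

lemma eventually_le_of_eventually_eq {ι : Type*} {l : Filter ι} {a : ι → V → ℕ} {b z : V → ℕ}
    (hlim : ∀ x, ∀ᶠ i in l, a i x = b x) (hz : z ∈ finiteConf V) (hzb : z ≤ b) :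
    ∀ᶠ i in l, z ≤ a i := by
  have hfin := finite_support_of_mem_finiteConf hz
  filter_upwards [(eventually_all_finite hfin).2 fun x _ => hlim x] with i hi x
  by_cases hx : x ∈ Function.support z
  · exact (hzb x).trans (hi x hx).ge
  · rw [Function.notMem_support.1 hx]
    exact zero_le

lemma eventually_eq_iSup {a : ℕ → ℕ} (ha : Monotone a) (hb : BddAbove (Set.range a)) :
    ∀ᶠ n in atTop, a n = ⨆ k, a k := by
  obtain ⟨k, hk⟩ := Nat.sSup_mem (Set.range_nonempty a) hb
  filter_upwards [eventually_ge_atTop k] with n hn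
  exact le_antisymm (le_ciSup hb n) (hk.ge.trans (ha hn))

lemma bddAbove_of_weight_le {ι : Type*} {w : V → ℝ≥0∞} {x : V} (hw : w x ≠ 0) {a : ι → V → ℕ}
    {B : ℝ≥0∞} (hB : B ≠ ∞) (ha : ∀ i, weight w (a i) ≤ B) :
    BddAbove (Set.range fun i => a i x) := by
  obtain ⟨N, hN⟩ := ENNReal.exists_nat_gt (ENNReal.div_ne_top hB hw)
  refine ⟨N, ?_⟩
  rintro _ ⟨i, rfl⟩
  have hx : w x * a i x ≤ B := (ENNReal.le_tsum (f := fun x => w x * a i x) x).trans (ha i)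
  have hdiv : (a i x : ℝ≥0∞) ≤ B / w x := by
    rwa [ENNReal.le_div_iff_mul_le (.inl hw) (.inr hB), mul_comm]
  exact_mod_cast (hdiv.trans_lt hN).le

lemma weight_iSup (w : V → ℝ≥0∞) {a : ℕ → V → ℕ} (ha : Monotone a)
    (hb : ∀ x, BddAbove (Set.range fun n => a n x)) :
    weight w (fun x => ⨆ n, a n x) = ⨆ n, weight w (a n) := by
  refine le_antisymm ?_ (iSup_le fun n => weight_mono w fun x => le_ciSup (hb x) n)
  rw [weight, ENNReal.tsum_eq_iSup_sum]
  refine iSup_le fun s => ?_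
  obtain ⟨n, hn⟩ := ((eventually_all_finset s).2 fun x _ =>
    eventually_eq_iSup (fun _ _ hnk => ha hnk x) (hb x)).exists
  refine le_iSup_of_le n (le_trans (le_of_eq ?_) (ENNReal.sum_le_tsum s))
  exact Finset.sum_congr rfl fun x hx => by rw [hn x hx]

end Convergence

section Truncate

variable {V : Type*} [Encodable V] (η : V → ℕ)

/-- The restriction of a configuration to the first `n` sites of an enumeration. -/
noncomputable def truncate (n : ℕ) : V → ℕ := fun x => if Encodable.encode x < n then η x else 0

lemma truncate_mem_finiteConf (n : ℕ) : truncate η n ∈ finiteConf V := by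
  refine summable_of_hasFiniteSupport
    (((Set.finite_Iio n).preimage Encodable.encode_injective.injOn).subset fun x hx => ?_)
  by_contra hlt
  exact hx (by simp [toRealConf, truncate, show ¬ Encodable.encode x < n from hlt])

lemma monotone_truncate : Monotone (truncate η) := by
  intro n k hnk x
  simp only [truncate]
  split_ifs <;> omega

lemma truncate_le (n : ℕ) : truncate η n ≤ η := by
  intro x
  simp only [truncate]
  split_ifs <;> omega

lemma eventually_truncate_eq (x : V) : ∀ᶠ n in atTop, truncate η n x = η x := by
  filter_upwards [eventually_gt_atTop (Encodable.encode x)] with n hn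
  exact if_pos hn

end Truncate

/-! ### The flow on infinite configurations -/

section Regular

variable {V : Type*} {p : V → V → ℝ} {Fp Fm : ℕ → ℝ} {X : Mark V → Set (ℝ × ℝ)} {t : ℝ}

/-- The realizations `X` of the noise that drive every finite configuration for all times. -/
structure Regular (p : V → V → ℝ) (Fp Fm : ℕ → ℝ) (X : Mark V → Set (ℝ × ℝ)) : Prop where
  exists_evolves : ∀ z ∈ finiteConf V, ∀ t, 0 ≤ t →
    ∃ z', Evolves transition (rate p Fp Fm) X 0 z t z'
  noSimultaneousPoints : NoSimultaneousPoints X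

lemma Regular.flow_mono (h : Regular p Fp Fm X) (hΓ : IsAttractive transition (rate p Fp Fm))
    {z w : V → ℕ} (hz : z ∈ finiteConf V) (hw : w ∈ finiteConf V) (hle : z ≤ w) (ht : 0 ≤ t) :
    flow p Fp Fm X 0 t z ≤ flow p Fp Fm X 0 t w := by
  obtain ⟨z', hz'⟩ := h.exists_evolves z hz t ht
  obtain ⟨w', hw'⟩ := h.exists_evolves w hw t ht
  rw [hz'.flow_eq, hw'.flow_eq]
  exact hz'.mono hΓ h.noSimultaneousPoints le_rfl hw' hle

variable [Encodable V] {η : V → ℕ} {w : V → ℝ≥0∞}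

/-- The flow started from `η`, as the limit of the flows started from its finite restrictions; the
suprema over `n` have the value `0` where they are infinite. -/
noncomputable def limitFlow (p : V → V → ℝ) (Fp Fm : ℕ → ℝ) (X : Mark V → Set (ℝ × ℝ)) (η : V → ℕ)
    (t : ℝ) : V → ℕ :=
  fun x => ⨆ n, flow p Fp Fm X 0 t (truncate η n) x

lemma Regular.monotone_flow_truncate (h : Regular p Fp Fm X)
    (hΓ : IsAttractive transition (rate p Fp Fm)) (η : V → ℕ) (ht : 0 ≤ t) :
    Monotone fun n => flow p Fp Fm X 0 t (truncate η n) := fun n k hnk =>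
  h.flow_mono hΓ (truncate_mem_finiteConf η n) (truncate_mem_finiteConf η k)
    (monotone_truncate η hnk) ht

/-- The regular realizations `X` for which the flows started from the finite restrictions of `η`
have bounded `w`-weight at each time. -/
structure RegularFrom (p : V → V → ℝ) (Fp Fm : ℕ → ℝ) (w : V → ℝ≥0∞) (η : V → ℕ)
    (X : Mark V → Set (ℝ × ℝ)) : Prop extends Regular p Fp Fm X where
  iSup_weight_ne_top : ∀ t, 0 ≤ t → ⨆ n, weight w (flow p Fp Fm X 0 t (truncate η n)) ≠ ∞

namespace RegularFrom

variable (h : RegularFrom p Fp Fm w η X) (hΓ : IsAttractive transition (rate p Fp Fm))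
  (hw : ∀ x, w x ≠ 0) (ht : 0 ≤ t)

include h hw ht

lemma bddAbove_flow_truncate (x : V) :
    BddAbove (Set.range fun n => flow p Fp Fm X 0 t (truncate η n) x) :=
  bddAbove_of_weight_le (hw x) (h.iSup_weight_ne_top t ht) fun n =>
    le_iSup (fun n => weight w (flow p Fp Fm X 0 t (truncate η n))) n

include hΓ

lemma weight_limitFlow : weight w (limitFlow p Fp Fm X η t)
    = ⨆ n, weight w (flow p Fp Fm X 0 t (truncate η n)) :=
  weight_iSup w (h.monotone_flow_truncate hΓ η ht) (h.bddAbove_flow_truncate hw ht)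

lemma weight_limitFlow_ne_top : weight w (limitFlow p Fp Fm X η t) ≠ ∞ :=
  (h.weight_limitFlow hΓ hw ht).trans_ne (h.iSup_weight_ne_top t ht)

lemma flow_le_limitFlow {z : V → ℕ} (hz : z ∈ finiteConf V) (hle : z ≤ η) :
    flow p Fp Fm X 0 t z ≤ limitFlow p Fp Fm X η t := by
  obtain ⟨k, hk⟩ := (eventually_le_of_eventually_eq (eventually_truncate_eq η) hz hle).exists
  exact (h.flow_mono hΓ hz (truncate_mem_finiteConf η k) hk ht).trans fun x =>
    le_ciSup (h.bddAbove_flow_truncate hw ht x) k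

lemma eventually_flow_eq_limitFlow {a : ℕ → V → ℕ} (ha : ∀ n, a n ∈ finiteConf V)
    (hle : ∀ n, a n ≤ η) (hlim : ∀ x, ∀ᶠ n in atTop, a n x = η x) (x : V) :
    ∀ᶠ n in atTop, flow p Fp Fm X 0 t (a n) x = limitFlow p Fp Fm X η t x := by
  obtain ⟨k, hk⟩ := (eventually_eq_iSup (fun _ _ hnk => h.monotone_flow_truncate hΓ η ht hnk x)
    (h.bddAbove_flow_truncate hw ht x)).exists
  have hfin := truncate_mem_finiteConf η k
  filter_upwards [eventually_le_of_eventually_eq hlim hfin (truncate_le η k)] with n hn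
  exact le_antisymm (h.flow_le_limitFlow hΓ hw ht (ha n) (hle n) x)
    (hk.ge.trans (h.flow_mono hΓ hfin (ha n) hn ht x))

end RegularFrom

lemma RegularFrom.tendsto_flow {α : V → ℝ} (h : RegularFrom p Fp Fm (alphaWeight α) η X)
    (hΓ : IsAttractive transition (rate p Fp Fm)) (hα : ∀ x, 0 < α x) (ht : 0 ≤ t)
    {a : ℕ → V → ℕ} (hmono : Monotone a) (ha : ∀ n, a n ∈ finiteConf V)
    (hlim : Tendsto (fun n => alphaNorm α (toRealConf (a n) - toRealConf η)) atTop (𝓝 0)) :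
    Tendsto (fun n => alphaNorm α
      (toRealConf (flow p Fp Fm X 0 t (a n)) - toRealConf (limitFlow p Fp Fm X η t)))
      atTop (𝓝 0) := by
  have hw := alphaWeight_ne_zero hα
  have hev := eventually_eq_of_tendsto_alphaNorm_sub hα hlim
  have hle (n : ℕ) : a n ≤ η := fun x => by
    obtain ⟨k, hk, hnk⟩ := ((hev x).and (eventually_ge_atTop n)).exists
    exact (hmono hnk x).trans hk.le
  exact tendsto_alphaNorm_sub hα (h.weight_limitFlow_ne_top hΓ hw ht)
    (fun n => h.flow_le_limitFlow hΓ hw ht (ha n) (hle n))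
    (h.eventually_flow_eq_limitFlow hΓ hw ht ha hle hev)

end Regular

section Noise

variable {V Ω : Type*} [MeasurableSpace Ω] {μ : Measure Ω} [IsProbabilityMeasure μ]
  {X : Mark V → Ω → Set (ℝ × ℝ)} (hX : IsPoissonNoise X μ)
  {p : V → V → ℝ} {Fp Fm : ℕ → ℝ} {L : ℝ≥0} (hF : IsSubcritical p Fp Fm L)

include hX hF

lemma ae_regular [Countable V] : ∀ᵐ ω ∂μ, Regular p Fp Fm fun m => X m ω := by
  have hevolves : ∀ᵐ ω ∂μ, ∀ z : V →₀ ℕ, ∀ t, 0 ≤ t →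
      ∃ z', Evolves transition (rate p Fp Fm) (fun m => X m ω) 0 z t z' :=
    ae_all_iff.2 fun z => hX.ae_exists_evolves hF.isLyapunov_mass
      (summable_of_hasFiniteSupport (z.hasFiniteSupport.subset fun x hx => by
        simpa [toRealConf] using hx))
  filter_upwards [hevolves, hX.ae_noSimultaneousPoints] with ω hω hsimul
  exact ⟨fun z hz => hω (Finsupp.ofSupportFinite z (finite_support_of_mem_finiteConf hz)), hsimul⟩

variable [Encodable V] {w : V → ℝ≥0∞} (hw : ∀ x, w x ≠ ∞) {c : ℝ≥0}
  (hpw : ∀ x, ∑' y, ENNReal.ofReal (p x y) * w y ≤ c * w x) {η : V → ℕ} {T : ℝ}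

include hw hpw

lemma measure_lt_iSup_weight_flow_truncate_le (hT : 0 ≤ T) {A : ℝ≥0∞} (hA : A ≠ 0) (hA' : A ≠ ∞) :
    μ {ω | A < ⨆ n, ⨆ t ∈ Set.Icc 0 T,
        weight w (flow p Fp Fm (fun m => X m ω) 0 t (truncate η n))}
      ≤ ENNReal.ofReal (Real.exp (c * T)) * weight w η / A := by
  set U : ℕ → Set Ω := fun n => {ω | Regular p Fp Fm (fun m => X m ω) ∧
    A < ⨆ t ∈ Set.Icc 0 T, weight w (flow p Fp Fm (fun m => X m ω) 0 t (truncate η n))}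
  have hU : Monotone U := by
    rintro n k hnk ω ⟨hω, hlt⟩
    refine ⟨hω, hlt.trans_le (iSup₂_mono fun t ht => weight_mono w ?_)⟩
    exact hω.monotone_flow_truncate hF.isAttractive η ht.1 hnk
  calc _ ≤ μ (⋃ n, U n) := by
        refine measure_mono_ae ?_
        filter_upwards [ae_regular hX hF] with ω hω hlt
        obtain ⟨n, hn⟩ := lt_iSup_iff.1 (show A < _ from hlt)
        exact Set.mem_iUnion.2 ⟨n, hω, hn⟩
    _ = ⨆ n, μ (U n) := hU.measure_iUnion
    _ ≤ _ := by
        refine iSup_le fun n => (measure_mono fun ω hω => hω.2).trans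
          ((hX.measure_lt_iSup_le hF.isLyapunov_mass (truncate_mem_finiteConf η n) hT
            (fun _ _ _ hev => hev.flow_eq) (hF.hasDriftBound_weight hw hpw) hA hA').trans ?_)
        gcongr
        exact weight_mono w (truncate_le η n)

variable (hη : weight w η ≠ ∞)

include hη

lemma ae_iSup_weight_flow_truncate_ne_top (hT : 0 ≤ T) :
    ∀ᵐ ω ∂μ, ⨆ n, ⨆ t ∈ Set.Icc 0 T,
      weight w (flow p Fp Fm (fun m => X m ω) 0 t (truncate η n)) ≠ ∞ := by
  rw [ae_iff]
  simp only [not_not]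
  have hlim := tendsto_div_natCast_succ
    (ENNReal.mul_ne_top ENNReal.ofReal_ne_top hη : ENNReal.ofReal (Real.exp (c * T)) * _ ≠ ∞)
  refine le_antisymm (ge_of_tendsto' hlim fun K => ?_) zero_le
  refine (measure_mono fun ω hω => ?_).trans (measure_lt_iSup_weight_flow_truncate_le hX hF hw hpw
    hT (A := ((K + 1 : ℕ) : ℝ≥0∞)) (by simp) (ENNReal.natCast_ne_top _))
  exact (ENNReal.natCast_lt_top (K + 1)).trans_eq (show _ = ∞ from hω).symm

lemma ae_regularFrom : ∀ᵐ ω ∂μ, RegularFrom p Fp Fm w η fun m => X m ω := by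
  have hfinite : ∀ᵐ ω ∂μ, ∀ N : ℕ, ⨆ n, ⨆ t ∈ Set.Icc 0 (N : ℝ),
      weight w (flow p Fp Fm (fun m => X m ω) 0 t (truncate η n)) ≠ ∞ :=
    ae_all_iff.2 fun N => ae_iSup_weight_flow_truncate_ne_top hX hF hw hpw hη N.cast_nonneg
  filter_upwards [hfinite, ae_regular hX hF] with ω hω hreg
  refine ⟨hreg, fun t ht => ?_⟩
  obtain ⟨N, hN⟩ := exists_nat_ge t
  refine ne_top_of_le_ne_top (hω N) (iSup_mono fun n => ?_)
  exact le_iSup₂ (f := fun t (_ : t ∈ Set.Icc 0 (N : ℝ)) =>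
    weight w (flow p Fp Fm (fun m => X m ω) 0 t (truncate η n))) t ⟨ht, hN⟩

variable (hw₀ : ∀ x, w x ≠ 0)

include hw₀

lemma iSup_weight_flow_truncate_ae_eq (T : ℝ) :
    (fun ω => ⨆ n, ⨆ t ∈ Set.Icc 0 T, weight w (flow p Fp Fm (fun m => X m ω) 0 t (truncate η n)))
      =ᵐ[μ] fun ω => ⨆ t ∈ Set.Icc 0 T, weight w (limitFlow p Fp Fm (fun m => X m ω) η t) := by
  filter_upwards [ae_regularFrom hX hF hw hpw hη] with ω hω
  rw [iSup_comm]
  refine iSup_congr fun t => ?_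
  rw [iSup_comm]
  exact iSup_congr fun ht => (hω.weight_limitFlow hF.isAttractive hw₀ ht.1).symm

lemma measure_lt_iSup_weight_limitFlow_le (hT : 0 ≤ T) {A : ℝ≥0∞} (hA : A ≠ 0) (hA' : A ≠ ∞) :
    μ {ω | A < ⨆ t ∈ Set.Icc 0 T, weight w (limitFlow p Fp Fm (fun m => X m ω) η t)}
      ≤ ENNReal.ofReal (Real.exp (c * T)) * weight w η / A := by
  refine (measure_mono_ae ?_).trans
    (measure_lt_iSup_weight_flow_truncate_le (η := η) hX hF hw hpw hT hA hA')
  filter_upwards [iSup_weight_flow_truncate_ae_eq hX hF hw hpw hη hw₀ T] with ω hω hlt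
  exact (show A < _ from hlt).trans_eq hω.symm

lemma aemeasurable_iSup_weight_limitFlow (hT : 0 ≤ T) :
    AEMeasurable (fun ω => ⨆ t ∈ Set.Icc 0 T,
      weight w (limitFlow p Fp Fm (fun m => X m ω) η t)) μ :=
  (AEMeasurable.iSup fun n => hX.aemeasurable_iSup hF.isLyapunov_mass (truncate_mem_finiteConf η n)
    hT (fun _ _ _ hev => hev.flow_eq) (weight w)).congr
    (iSup_weight_flow_truncate_ae_eq hX hF hw hpw hη hw₀ T)

lemma iSup_weight_flow_truncate_apply_ae_eq (hT : 0 ≤ T) :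
    (fun ω => ⨆ n, weight w (flow p Fp Fm (fun m => X m ω) 0 T (truncate η n)))
      =ᵐ[μ] fun ω => weight w (limitFlow p Fp Fm (fun m => X m ω) η T) := by
  filter_upwards [ae_regularFrom hX hF hw hpw hη] with ω hω
  exact (hω.weight_limitFlow hF.isAttractive hw₀ hT).symm

lemma aemeasurable_weight_limitFlow (hT : 0 ≤ T) :
    AEMeasurable (fun ω => weight w (limitFlow p Fp Fm (fun m => X m ω) η T)) μ :=
  (AEMeasurable.iSup fun n => hX.aemeasurable_apply hF.isLyapunov_mass (truncate_mem_finiteConf η n)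
    hT (fun _ _ _ hev => hev.flow_eq) (weight w)).congr
    (iSup_weight_flow_truncate_apply_ae_eq hX hF hw hpw hη hw₀ hT)

lemma lintegral_weight_limitFlow_le (hT : 0 ≤ T) :
    ∫⁻ ω, weight w (limitFlow p Fp Fm (fun m => X m ω) η T) ∂μ
      ≤ ENNReal.ofReal (Real.exp (c * T)) * weight w η := by
  rw [← lintegral_congr_ae (iSup_weight_flow_truncate_apply_ae_eq hX hF hw hpw hη hw₀ hT),
    lintegral_iSup' fun n => hX.aemeasurable_apply hF.isLyapunov_mass
      (truncate_mem_finiteConf η n) hT (fun _ _ _ hev => hev.flow_eq) (weight w)]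
  · refine iSup_le fun n => (hX.lintegral_apply_le hF.isLyapunov_mass (truncate_mem_finiteConf η n)
      hT (fun _ _ _ hev => hev.flow_eq) (hF.hasDriftBound_weight hw hpw)).trans ?_
    gcongr
    exact weight_mono w (truncate_le η n)
  · filter_upwards [ae_regular hX hF] with ω hω n k hnk
    exact weight_mono w (hω.monotone_flow_truncate hF.isAttractive η hT hnk)

end Noise

section Kernel

variable {V : Type*} {p : V → V → ℝ} (hp : IsTransitionKernel p)

include hp

lemma IsTransitionKernel.tsum_ofReal (x : V) : ∑' y, ENNReal.ofReal (p x y) = 1 := by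
  rw [← ENNReal.ofReal_tsum_of_nonneg (hp.nonneg x) (hp.hasSum_one x).summable,
    (hp.hasSum_one x).tsum_eq, ENNReal.ofReal_one]

lemma IsTransitionKernel.isSubcritical {Fp Fm : ℕ → ℝ} (hF : IsReactionPair Fp Fm) :
    IsSubcritical p Fp Fm 1 where
  jump_nonneg := hp.nonneg
  tsum_jump_le x := (hp.tsum_ofReal x).le
  death_zero := hF.death_zero
  birth_le_death := hF.birth_le_death

lemma IsTransitionKernel.tsum_ofReal_mul_le {α : V → ℝ} (hα : ∀ x, 0 ≤ α x) (hα' : Summable α)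
    {C : ℝ≥0} {x : V} (hpα : ∑' y, p x y * α y ≤ C * α x) :
    ∑' y, ENNReal.ofReal (p x y) * ENNReal.ofReal (α y) ≤ C * ENNReal.ofReal (α x) := by
  have hnonneg (y : V) : 0 ≤ p x y * α y := mul_nonneg (hp.nonneg x y) (hα y)
  have hle (y : V) : p x y ≤ 1 := le_hasSum (hp.hasSum_one x) y fun z _ => hp.nonneg x z
  have hsum : Summable fun y => p x y * α y :=
    hα'.of_nonneg_of_le hnonneg fun y => mul_le_of_le_one_left (hα y) (hle y)
  simp only [← ENNReal.ofReal_mul (hp.nonneg x _)]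
  rw [← ENNReal.ofReal_tsum_of_nonneg hnonneg hsum, ← ENNReal.ofReal_coe_nnreal,
    ← ENNReal.ofReal_mul C.coe_nonneg]
  exact ENNReal.ofReal_le_ofReal hpα

end Kernel

end ReactionDiffusion

open ReactionDiffusion in
theorem mainTheorem6_general {V : Type*} [Countable V] {p : V → V → ℝ} {Fp Fm : ℕ → ℝ} {L : ℝ≥0}
    (hF : IsSubcritical p Fp Fm L) {α : V → ℝ} (hα : ∀ x, 0 < α x) {C : ℝ≥0}
    (hpα : ∀ x, ∑' y, ENNReal.ofReal (p x y) * ENNReal.ofReal (α y) ≤ C * ENNReal.ofReal (α x))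
    {Ω : Type*} [MeasurableSpace Ω] {μ : Measure Ω} [IsProbabilityMeasure μ]
    {X : Mark V → Ω → Set (ℝ × ℝ)} (hX : IsPoissonNoise X μ) {η : V → ℕ} (hη : η ∈ alphaConf α) :
    ∃ Φη : ℝ → Ω → V → ℕ,
      (∀ᵐ ω ∂μ, ∀ t : ℝ, 0 ≤ t → Φη t ω ∈ alphaConf α) ∧
      (∀ᵐ ω ∂μ, ∀ ηs : ℕ → V → ℕ, Monotone ηs → (∀ n, ηs n ∈ finiteConf V) →
        Tendsto (fun n => alphaNorm α (toRealConf (ηs n) - toRealConf η)) atTop (𝓝 0) →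
        ∀ t : ℝ, 0 ≤ t →
          Tendsto (fun n => alphaNorm α
            (toRealConf (flow p Fp Fm (fun m => X m ω) 0 t (ηs n)) - toRealConf (Φη t ω)))
            atTop (𝓝 0)) ∧
      (∀ T A : ℝ, 0 ≤ T → 0 < A →
        NullMeasurableSet
          {ω | ENNReal.ofReal A < ⨆ t ∈ Set.Icc 0 T, alphaNorm α (toRealConf (Φη t ω))} μ ∧
        μ {ω | ENNReal.ofReal A < ⨆ t ∈ Set.Icc 0 T, alphaNorm α (toRealConf (Φη t ω))}
          ≤ ENNReal.ofReal (Real.exp (C * T)) * alphaNorm α (toRealConf η) / ENNReal.ofReal A) ∧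
      (∀ t : ℝ, 0 ≤ t →
        AEMeasurable (fun ω => alphaNorm α (toRealConf (Φη t ω))) μ ∧
        ∫⁻ ω, alphaNorm α (toRealConf (Φη t ω)) ∂μ
          ≤ ENNReal.ofReal (Real.exp (C * t)) * alphaNorm α (toRealConf η)) := by
  have _ := Encodable.ofCountable V
  have hw := alphaWeight_ne_top α
  have hw₀ := alphaWeight_ne_zero hα
  have hη' := (mem_alphaConf_iff hα).1 hη
  have hreg := ae_regularFrom hX hF hw hpα hη'
  simp only [mem_alphaConf_iff hα, alphaNorm_toRealConf hα]
  refine ⟨fun t ω => limitFlow p Fp Fm (fun m => X m ω) η t, ?_, ?_, fun T A hT hA => ⟨?_, ?_⟩,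
    fun t ht => ⟨?_, ?_⟩⟩
  · filter_upwards [hreg] with ω hω t ht
    exact hω.weight_limitFlow_ne_top hF.isAttractive hw₀ ht
  · filter_upwards [hreg] with ω hω ηs hmono hηs hlim t ht
    exact hω.tendsto_flow hF.isAttractive hα ht hmono hηs hlim
  · exact nullMeasurableSet_lt aemeasurable_const
      (aemeasurable_iSup_weight_limitFlow hX hF hw hpα hη' hw₀ hT)
  · exact measure_lt_iSup_weight_limitFlow_le hX hF hw hpα hη' hw₀ hT
      (ENNReal.ofReal_pos.2 hA).ne' ENNReal.ofReal_ne_top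
  · exact aemeasurable_weight_limitFlow hX hF hw hpα hη' hw₀ ht
  · exact lintegral_weight_limitFlow_le hX hF hw hpα hη' hw₀ ht

open ReactionDiffusion in
theorem mainTheorem6 {V : Type*} [Countable V]
    (p : V → V → ℝ) (hp : IsTransitionKernel p)
    (α : V → ℝ) (hα : IsLocalization p α)
    (C : ℝ) (hC : 0 < C) (hpα : ∀ x, ∑' y, p x y * α y ≤ C * α x)
    (Fp Fm : ℕ → ℝ) (hF : IsReactionPair Fp Fm)
    {Ω : Type*} [MeasurableSpace Ω] (μ : Measure Ω) [IsProbabilityMeasure μ]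
    (X : Mark V → Ω → Set (ℝ × ℝ))
    (hX : ∀ m, IsPoissonPointProcess (X m)
      ((volume : Measure (ℝ × ℝ)).restrict (Set.Ioi 0 ×ˢ Set.Ioi 0)) μ)
    (hXind : iIndep (fun m => countSigma (X m)) μ)
    (η : V → ℕ) (hη : η ∈ alphaConf α) :
    ∃ Φη : ℝ → Ω → V → ℕ,
      (∀ᵐ ω ∂μ, ∀ t : ℝ, 0 ≤ t → Φη t ω ∈ alphaConf α) ∧
      (∀ᵐ ω ∂μ, ∀ ηs : ℕ → V → ℕ, Monotone ηs → (∀ n, ηs n ∈ finiteConf V) →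
        Tendsto (fun n => alphaNorm α (toRealConf (ηs n) - toRealConf η)) atTop (𝓝 0) →
        ∀ t : ℝ, 0 ≤ t →
          Tendsto (fun n => alphaNorm α
            (toRealConf (flow p Fp Fm (fun m => X m ω) 0 t (ηs n)) - toRealConf (Φη t ω)))
            atTop (𝓝 0)) ∧
      (∀ T A : ℝ, 0 ≤ T → 0 < A →
        NullMeasurableSet
          {ω | ENNReal.ofReal A < ⨆ t ∈ Set.Icc 0 T, alphaNorm α (toRealConf (Φη t ω))} μ ∧
        μ {ω | ENNReal.ofReal A < ⨆ t ∈ Set.Icc 0 T, alphaNorm α (toRealConf (Φη t ω))}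
          ≤ ENNReal.ofReal (Real.exp ((C + 1) * T)) * alphaNorm α (toRealConf η)
            / ENNReal.ofReal A) ∧
      (∀ t : ℝ, 0 ≤ t →
        AEMeasurable (fun ω => alphaNorm α (toRealConf (Φη t ω))) μ ∧
        ∫⁻ ω, alphaNorm α (toRealConf (Φη t ω)) ∂μ < ∞) := by
  lift C to ℝ≥0 using hC.le
  obtain ⟨Φη, hmem, hlim, hmax, hint⟩ := mainTheorem6_general (hp.isSubcritical hF) hα.pos
    (fun x => hp.tsum_ofReal_mul_le (fun y => (hα.pos y).le) hα.summable (hpα x)) ⟨hX, hXind⟩ hη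
  refine ⟨Φη, hmem, hlim, fun T A hT hA => ⟨(hmax T A hT hA).1, (hmax T A hT hA).2.trans ?_⟩,
    fun t ht => ⟨(hint t ht).1,
      (hint t ht).2.trans_lt (ENNReal.mul_lt_top ENNReal.ofReal_lt_top hη)⟩⟩
  gcongr
  exact le_add_of_nonneg_right zero_le_one
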